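/- A Lie category $\mathcal C\rightrightarrows\mathcal X$ is a small category whose set of arrows $\mathcal C$ is a smooth manifold with or without boundary and whose set of objects $\mathcal X$ is a smooth manifold without boundary, such that the source and target maps $s,t\colon\mathcal C\to\mathcal X$ and their restrictions to $\partial\mathcal C$ are smooth submersions, and the unit map $u\colon\mathcal X\to\mathcal C$ and the composition $(g,h)\mapsto gh$, defined for $s(g)=t(h)$, are smooth. Its left Lie algebroid $A^L(\mathcal C)$ is the vector bundle $u^*(\ker \mathrm dt)$ over $\mathcal X$ with the anchor $\mathrm ds$ and the bracket $[\alpha,\beta]=[\alpha^L,\beta^L]\circ u$, where $\alpha^L(g)=\mathrm d(L_g)_{u(s(g))}(\alpha_{s(g)})$ is the left-invariant extension of a section $\alpha$. Its right Lie algebroid $A^R(\mathcal C)$ is $u^*(\ker\mathrm ds)$ with the anchor $\mathrm dt$ and the bracket defined in the same way by right-invariant extensions. Its core $\mathcal G(\mathcal C)$ is the set of invertible arrows. **Proposition.** Let $\mathcal C\rightrightarrows\mathcal X$ be a Lie category with $u(\mathcal X)\subset\operatorname{Int}\mathcal C$. Then $\mathcal G(\mathcal C)$ is open in $\mathcal C$,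 and as an open submanifold it is a Lie groupoid over $\mathcal X$ without boundary. The left and the right Lie algebroids of $\mathcal C$ and of $\mathcal G(\mathcal C)$ are Lie algebroids (in particular their brackets are well defined on smooth sections), and there are isomorphisms of Lie algebroids over $\mathrm{id}_{\mathcal X}$ $$A^L(\mathcal C)\cong A^L(\mathcal G(\mathcal C))\cong A^R(\mathcal G(\mathcal C))\cong A^R(\mathcal C),$$ of which the first and the last are induced by the differential of the inclusion $\mathcal G(\mathcal C)\hookrightarrow\mathcal C$ and the middle one by the differential of the inversion of $\mathcal G(\mathcal C)$. In particular, both $A^L(\mathcal C)$ and $A^R(\mathcal C)$ are isomorphic to the Lie algebroid $A^L(\mathcal G(\mathcal C))\cong A^R(\mathcal G(\mathcal C))$ of the core. -/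

import Mathlib

open scoped Manifold ContDiff Topology

noncomputable section

/-! ## Small categories as sets of arrows -/

/-- A small category `C ⇉ X` with set of arrows `C` and set of objects `X`: source `s`, target `t`,
units `u` and composition `m g h = gh`, which is defined for `s g = t h`. The function `m` is total
for convenience only: its values at pairs that are not composable carry no meaning, and no
definition below depends on them. -/
structure ArrowCat (C X : Type*) where
  s : C → X
  t : C → X
  u : X → C
  m : C → C → C
  s_u : ∀ x, s (u x) = x
  t_u : ∀ x, t (u x) = x
  s_m : ∀ g h, s g = t h → s (m g h) = s h
  t_m : ∀ g h, s g = t h → t (m g h) = t g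
  m_u : ∀ g, m g (u (s g)) = g
  u_m : ∀ g, m (u (t g)) g = g
  assoc : ∀ g h k, s g = t h → s h = t k → m (m g h) k = m g (m h k)

namespace ArrowCat

section Algebra

variable {C X : Type*} (𝒞 : ArrowCat C X)

/-- The opposite category. -/
def op : ArrowCat C X where
  s := 𝒞.t
  t := 𝒞.s
  u := 𝒞.u
  m g h := 𝒞.m h g
  s_u := 𝒞.t_u
  t_u := 𝒞.s_u
  s_m g h e := 𝒞.t_m h g e.symm
  t_m g h e := 𝒞.s_m h g e.symm
  m_u := 𝒞.u_m
  u_m := 𝒞.m_u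
  assoc g h k e f := (𝒞.assoc k h g f.symm e.symm).symm

/-- The set of composable pairs. -/
def composable : Set (C × C) := {p | 𝒞.s p.1 = 𝒞.t p.2}

/-- The target fibre `C^x = t⁻¹(x)`. -/
def tFibre (x : X) : Set C := {h | 𝒞.t h = x}

/-- `g'` is a two-sided inverse of `g`. -/
def IsInverse (g g' : C) : Prop :=
  𝒞.s g' = 𝒞.t g ∧ 𝒞.t g' = 𝒞.s g ∧ 𝒞.m g' g = 𝒞.u (𝒞.s g) ∧ 𝒞.m g g' = 𝒞.u (𝒞.t g)

/-- The set of invertible arrows. -/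
def core : Set C := {g | ∃ g', 𝒞.IsInverse g g'}

theorem u_mem_core (x : X) : 𝒞.u x ∈ 𝒞.core := by
  refine ⟨𝒞.u x, by rw [𝒞.s_u, 𝒞.t_u], by rw [𝒞.s_u, 𝒞.t_u], ?_, ?_⟩
  · have h := 𝒞.m_u (𝒞.u x)
    rw [𝒞.s_u] at h ⊢
    exact h
  · have h := 𝒞.u_m (𝒞.u x)
    rw [𝒞.t_u] at h ⊢
    exact h

theorem m_mem_core {g h : C} (e : 𝒞.s g = 𝒞.t h) (hg : g ∈ 𝒞.core) (hh : h ∈ 𝒞.core) :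
    𝒞.m g h ∈ 𝒞.core := by
  obtain ⟨g', g1, g2, g3, g4⟩ := hg
  obtain ⟨h', h1, h2, h3, h4⟩ := hh
  have e' : 𝒞.s h' = 𝒞.t g' := by rw [h1, g2, e]
  refine ⟨𝒞.m h' g', ?_, ?_, ?_, ?_⟩
  · rw [𝒞.s_m _ _ e', 𝒞.t_m _ _ e, g1]
  · rw [𝒞.t_m _ _ e', 𝒞.s_m _ _ e, h2]
  · rw [𝒞.assoc _ _ _ e' (by rw [𝒞.t_m _ _ e, g1]), ← 𝒞.assoc g' g h g1 e, g3, e, 𝒞.u_m, h3,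
      𝒞.s_m _ _ e]
  · rw [𝒞.assoc _ _ _ e (by rw [𝒞.t_m _ _ e', h2]), ← 𝒞.assoc h h' g' h2.symm e', h4, ← e, ← g2,
      𝒞.u_m, g4, 𝒞.t_m _ _ e]

open Classical in
/-- Inversion, on invertible arrows; other arrows are left fixed, which carries no meaning. -/
def inv (g : C) : C := if h : ∃ g', 𝒞.IsInverse g g' then h.choose else g

variable [TopologicalSpace C]

/-- The core as an open subset of the space of arrows. It carries the manifold structure of an
open submanifold. -/
def coreOpens (hG : IsOpen 𝒞.core) : TopologicalSpace.Opens C := ⟨𝒞.core, hG⟩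

open Classical in
/-- The core `G(C) ⇉ X`, a category with the structure maps of `C`. -/
def coreCat (hG : IsOpen 𝒞.core) : ArrowCat (𝒞.coreOpens hG) X where
  s g := 𝒞.s g.1
  t g := 𝒞.t g.1
  u x := ⟨𝒞.u x, 𝒞.u_mem_core x⟩
  m g h := if e : 𝒞.s g.1 = 𝒞.t h.1 then ⟨𝒞.m g.1 h.1, 𝒞.m_mem_core e g.2 h.2⟩ else g
  s_u x := 𝒞.s_u x
  t_u x := 𝒞.t_u x
  s_m g h e := by rw [dif_pos e]; exact 𝒞.s_m _ _ e
  t_m g h e := by rw [dif_pos e]; exact 𝒞.t_m _ _ e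
  m_u g := by rw [dif_pos (𝒞.t_u _).symm]; exact Subtype.ext (𝒞.m_u _)
  u_m g := by rw [dif_pos (𝒞.s_u _)]; exact Subtype.ext (𝒞.u_m _)
  assoc g h k e f := by
    rw [dif_pos e, dif_pos f, dif_pos (by rw [𝒞.s_m _ _ e]; exact f),
      dif_pos (by rw [𝒞.t_m _ _ f]; exact e)]
    exact Subtype.ext (𝒞.assoc _ _ _ e f)

end Algebra

end ArrowCat

/-! ## Manifolds with or without boundary -/

section Boundary

variable {E H : Type*} [NormedAddCommGroup E] [NormedSpace ℝ E] [TopologicalSpace H]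
  (I : ModelWithCorners ℝ E H)

/-- The model of a manifold with or without boundary: its image in the vector space `E` is a closed
half-space (`ℓ ≠ 0`) or all of `E` (`ℓ = 0`). -/
def IsBoundaryModel : Prop := ∃ ℓ : E →L[ℝ] ℝ, Set.range I = {x | 0 ≤ ℓ x}

/-- The tangent space `T_g ∂C ⊆ T_g C` of the boundary at a boundary point `g`: the velocities of
smooth curves in the boundary. -/
def boundaryTangent {C : Type*} [TopologicalSpace C] [ChartedSpace H C] (g : C) :
    Set (TangentSpace I g) :=
  {v | ∃ γ : ℝ → C, ContMDiff 𝓘(ℝ, ℝ) I ∞ γ ∧ (∀ τ, γ τ ∈ I.boundary C) ∧ γ 0 = g ∧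
    (mfderiv 𝓘(ℝ, ℝ) I γ 0 (1 : ℝ) : E) = v}

end Boundary

/-! ## Lie categories and Lie groupoids -/

namespace ArrowCat

section Lie

variable {E H C : Type*} (F : Type*) {X : Type*} [NormedAddCommGroup E] [NormedSpace ℝ E] [TopologicalSpace H]
  (I : ModelWithCorners ℝ E H) [TopologicalSpace C] [ChartedSpace H C]
  [NormedAddCommGroup F] [NormedSpace ℝ F] [TopologicalSpace X] [ChartedSpace F X]
  (𝒞 : ArrowCat C X)

/-- A Lie category `C ⇉ X`, for a manifold `C` with or without boundary and a manifold `X` without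
boundary, both smooth. Since `s` and `t` and their restrictions to `∂C` are submersions, the set
of composable pairs is a neat submanifold of `C × C`, and smoothness of a map on it is smoothness
on this subset. -/
structure IsLieCategory : Prop where
  smooth_s : ContMDiff I 𝓘(ℝ, F) ∞ 𝒞.s
  smooth_t : ContMDiff I 𝓘(ℝ, F) ∞ 𝒞.t
  submersion_s : ∀ g, Function.Surjective (mfderiv I 𝓘(ℝ, F) 𝒞.s g)
  submersion_t : ∀ g, Function.Surjective (mfderiv I 𝓘(ℝ, F) 𝒞.t g)
  smooth_u : ContMDiff 𝓘(ℝ, F) I ∞ 𝒞.u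
  smooth_m : ContMDiffOn (I.prod I) I ∞ (fun p : C × C => 𝒞.m p.1 p.2) 𝒞.composable
  boundary_submersion_s : ∀ g ∈ I.boundary C, ∀ w : TangentSpace 𝓘(ℝ, F) (𝒞.s g),
    ∃ v ∈ boundaryTangent I g, mfderiv I 𝓘(ℝ, F) 𝒞.s g v = w
  boundary_submersion_t : ∀ g ∈ I.boundary C, ∀ w : TangentSpace 𝓘(ℝ, F) (𝒞.t g),
    ∃ v ∈ boundaryTangent I g, mfderiv I 𝓘(ℝ, F) 𝒞.t g v = w

/-- A Lie groupoid: a Lie category in which every arrow is invertible, with smooth inversion. -/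
structure IsLieGroupoid : Prop where
  isLieCategory : 𝒞.IsLieCategory F I
  invertible : ∀ g, ∃ g', 𝒞.IsInverse g g'
  smooth_inv : ContMDiff I I ∞ 𝒞.inv

end Lie

end ArrowCat

/-! ## Lie algebroids -/

universe uF uX v

/-- The data of a Lie algebroid over a manifold `X` without boundary that is modelled on `F`: a
family of vector spaces over `X`, the notion of smoothness of its sections at a point, the anchor
and the bracket of sections. The laws are in `LieAlgebroidData.IsLieAlgebroid`. -/
structure LieAlgebroidData (F : Type uF) (X : Type uX) [NormedAddCommGroup F] [NormedSpace ℝ F]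
    [TopologicalSpace X] [ChartedSpace F X] where
  fibre : X → Type v
  [addCommGroup : ∀ x, AddCommGroup (fibre x)]
  [module : ∀ x, Module ℝ (fibre x)]
  IsSmoothAt : (∀ x, fibre x) → X → Prop
  anchor : ∀ x, fibre x →ₗ[ℝ] TangentSpace 𝓘(ℝ, F) x
  bracket : (∀ x, fibre x) → (∀ x, fibre x) → (∀ x, fibre x)

namespace LieAlgebroidData

attribute [instance] LieAlgebroidData.addCommGroup LieAlgebroidData.module

variable {F X : Type*} [NormedAddCommGroup F] [NormedSpace ℝ F]
  [TopologicalSpace X] [ChartedSpace F X]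

/-- A global smooth section. -/
def IsSmooth (A : LieAlgebroidData F X) (α : ∀ x, A.fibre x) : Prop := ∀ x, A.IsSmoothAt α x

/-- The derivative of a function `f` along a tangent vector `w` at `x`. -/
def dirDeriv (f : X → ℝ) (x : X) (w : TangentSpace 𝓘(ℝ, F) x) : ℝ :=
  mfderiv 𝓘(ℝ, F) 𝓘(ℝ, ℝ) f x w

/-- The laws of a Lie algebroid: the fibres form a smooth vector bundle, whose smooth sections are
the ones with smooth coordinates in the local trivializations `e`; the anchor is a smooth bundle
map; and the bracket is a Lie bracket on the smooth sections that is preserved by the anchor and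
satisfies the Leibniz rule. -/
structure IsLieAlgebroid [IsManifold 𝓘(ℝ, F) ∞ X] (A : LieAlgebroidData F X) : Prop where
  locally_trivial : ∃ r : ℕ, ∀ x₀ : X, ∃ U ∈ 𝓝 x₀, ∃ e : ∀ x, A.fibre x →ₗ[ℝ] (Fin r → ℝ),
    (∀ x ∈ U, Function.Bijective (e x)) ∧
    ∀ (α : ∀ x, A.fibre x), ∀ y ∈ U,
      A.IsSmoothAt α y ↔ ContMDiffAt 𝓘(ℝ, F) 𝓘(ℝ, Fin r → ℝ) ∞ (fun x => e x (α x)) y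
  anchor_smooth : ∀ (α : ∀ x, A.fibre x) (x : X), A.IsSmoothAt α x →
    ContMDiffAt 𝓘(ℝ, F) 𝓘(ℝ, F).tangent ∞
      (fun y => (⟨y, A.anchor y (α y)⟩ : TangentBundle 𝓘(ℝ, F) X)) x
  bracket_smooth : ∀ α β, A.IsSmooth α → A.IsSmooth β → A.IsSmooth (A.bracket α β)
  bracket_add : ∀ α β γ, A.IsSmooth α → A.IsSmooth β → A.IsSmooth γ →
    A.bracket α (β + γ) = A.bracket α β + A.bracket α γ
  bracket_skew : ∀ α β, A.IsSmooth α → A.IsSmooth β → A.bracket α β = -A.bracket β α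
  jacobi : ∀ α β γ, A.IsSmooth α → A.IsSmooth β → A.IsSmooth γ →
    A.bracket α (A.bracket β γ) = A.bracket (A.bracket α β) γ + A.bracket β (A.bracket α γ)
  anchor_bracket : ∀ α β, A.IsSmooth α → A.IsSmooth β → ∀ x,
    A.anchor x (A.bracket α β x) =
      VectorField.mlieBracket 𝓘(ℝ, F) (fun y => A.anchor y (α y)) (fun y => A.anchor y (β y)) x
  leibniz : ∀ α β, A.IsSmooth α → A.IsSmooth β →
    ∀ f : X → ℝ, ContMDiff 𝓘(ℝ, F) 𝓘(ℝ, ℝ) ∞ f → ∀ x,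
    A.bracket α (fun y => f y • β y) x =
      f x • A.bracket α β x + dirDeriv f x (A.anchor x (α x)) • β x

/-- An isomorphism of Lie algebroids over the identity of `X`: an isomorphism of smooth vector
bundles (a family of linear isomorphisms of the fibres that preserves and reflects smoothness of
sections) that commutes with the anchors and preserves the bracket of smooth sections. -/
structure Iso (A B : LieAlgebroidData F X) where
  toLinearEquiv : ∀ x, A.fibre x ≃ₗ[ℝ] B.fibre x
  smooth : ∀ (α : ∀ x, A.fibre x) (x : X),
    A.IsSmoothAt α x ↔ B.IsSmoothAt (fun y => toLinearEquiv y (α y)) x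
  anchor : ∀ x v, B.anchor x (toLinearEquiv x v) = A.anchor x v
  bracket : ∀ α β, A.IsSmooth α → A.IsSmooth β → ∀ x,
    toLinearEquiv x (A.bracket α β x) =
      B.bracket (fun y => toLinearEquiv y (α y)) (fun y => toLinearEquiv y (β y)) x

end LieAlgebroidData

/-! ## The left and the right Lie algebroid of a Lie category -/

namespace ArrowCat

section Algebroid

variable {E H C : Type*} (F : Type*) {X : Type*} [NormedAddCommGroup E] [NormedSpace ℝ E] [TopologicalSpace H]
  (I : ModelWithCorners ℝ E H) [TopologicalSpace C] [ChartedSpace H C] [IsManifold I ∞ C]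
  [NormedAddCommGroup F] [NormedSpace ℝ F] [TopologicalSpace X] [ChartedSpace F X]
  [IsManifold 𝓘(ℝ, F) ∞ X] (𝒞 : ArrowCat C X)

/-- The fibre of `A^L(C) = u^*(ker dt)` at `x`, a subspace of `T_{u(x)} C`. -/
def leftFibre (x : X) : Submodule ℝ (TangentSpace I (𝒞.u x)) :=
  LinearMap.ker (mfderiv I 𝓘(ℝ, F) 𝒞.t (𝒞.u x)).toLinearMap

/-- The left-invariant extension `α^L(g) = d(L_g)_{u(s(g))} (α_{s(g)})` of a section `α` of
`A^L(C)`. Here `L_g h = gh` is a map on the fibre `t⁻¹(s(g))`, and it is differentiated along this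
fibre; its derivative is applied to a vector tangent to the fibre only. The result is a tangent
vector at `g = m g (u (s g))`. -/
def leftExtension (α : ∀ x, 𝒞.leftFibre F I x) (g : C) : TangentSpace I g :=
  (mfderivWithin I I (𝒞.m g) (𝒞.tFibre (𝒞.s g)) (𝒞.u (𝒞.s g)) (α (𝒞.s g)).1 : E)

/-- The bracket of the left-invariant extensions of `α` and `β`, restricted to the units. -/
def leftBracketAtUnits (α β : ∀ x, 𝒞.leftFibre F I x) (x : X) : TangentSpace I (𝒞.u x) :=
  VectorField.mlieBracket I (𝒞.leftExtension F I α) (𝒞.leftExtension F I β) (𝒞.u x)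

open Classical in
/-- The left Lie algebroid `A^L(C) = u^*(ker dt)`, with the anchor `ds` and with the bracket of
left-invariant vector fields. A section is smooth if it is so as a map to `TC`. The second case in
the bracket does not occur for smooth sections, see `LeftBracketClosed`. -/
def leftAlgebroid : LieAlgebroidData F X where
  fibre x := 𝒞.leftFibre F I x
  IsSmoothAt α x := ContMDiffAt 𝓘(ℝ, F) I.tangent ∞
    (fun y => (⟨𝒞.u y, (α y).1⟩ : TangentBundle I C)) x
  anchor x :=
    ((mfderiv I 𝓘(ℝ, F) 𝒞.s (𝒞.u x)).toLinearMap.comp (𝒞.leftFibre F I x).subtype :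
      𝒞.leftFibre F I x →ₗ[ℝ] F)
  bracket α β x :=
    if h : 𝒞.leftBracketAtUnits F I α β x ∈ 𝒞.leftFibre F I x then ⟨_, h⟩ else 0

/-- The right Lie algebroid `A^R(C) = u^*(ker ds)`, with the anchor `dt` and with the bracket of
right-invariant vector fields: the left Lie algebroid of the opposite category, which interchanges
`s` with `t` and left translations with right ones. -/
def rightAlgebroid : LieAlgebroidData F X := 𝒞.op.leftAlgebroid F I

/-- At the units, the bracket of the left-invariant extensions of smooth sections of `A^L(C)` is
tangent to the target fibres, so that it defines a section of `A^L(C)`. -/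
def LeftBracketClosed : Prop :=
  ∀ α β, (𝒞.leftAlgebroid F I).IsSmooth α → (𝒞.leftAlgebroid F I).IsSmooth β →
    ∀ x, 𝒞.leftBracketAtUnits F I α β x ∈ 𝒞.leftFibre F I x

/-- `A^L(C)` is a Lie algebroid, with a bracket of sections that is the one of their left-invariant
extensions. -/
def HasLeftAlgebroid : Prop :=
  𝒞.LeftBracketClosed F I ∧ (𝒞.leftAlgebroid F I).IsLieAlgebroid

/-- `A^R(C)` is a Lie algebroid, with a bracket of sections that is the one of their
right-invariant extensions. -/
def HasRightAlgebroid : Prop :=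
  𝒞.op.LeftBracketClosed F I ∧ (𝒞.rightAlgebroid F I).IsLieAlgebroid

/-- A vector in a fibre of `A^L(C)`, as a tangent vector of `C` at a unit. -/
def leftVal {x : X} (v : (𝒞.leftAlgebroid F I).fibre x) : TangentSpace I (𝒞.u x) :=
  (show 𝒞.leftFibre F I x from v).1

/-- A vector in a fibre of `A^R(C)`, as a tangent vector of `C` at a unit. -/
def rightVal {x : X} (v : (𝒞.rightAlgebroid F I).fibre x) : TangentSpace I (𝒞.u x) :=
  (show 𝒞.op.leftFibre F I x from v).1

end Algebroid

end ArrowCat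

end

open scoped Manifold ContDiff Topology

set_option linter.unusedSectionVars false

noncomputable section

open VectorField Set

/-! ### Brackets of related vector fields, boundary allowed. -/

section

section Related
variable {E H M E' H' N : Type*} [NormedAddCommGroup E] [NormedSpace ℝ E] [TopologicalSpace H]
  {I : ModelWithCorners ℝ E H} [TopologicalSpace M] [ChartedSpace H M]
  [NormedAddCommGroup E'] [NormedSpace ℝ E'] [TopologicalSpace H']
  {J : ModelWithCorners ℝ E' H'} [TopologicalSpace N] [ChartedSpace H' N]

/-! Everything is computed in charts along the target fibres. Since `t` is a submersion and units
are interior points, near a unit `C` looks like `X × ℝ^r` with `t` as the projection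
(`nonempty_fibreChart`). A fibre is in general not a set of unique differentiability in `C`, so the
derivative of `L_g` along it is determined only on `ker dt`. Parametrizing the fibre turns it into
an ordinary partial derivative, which gives uniqueness on `ker dt`
(`HasMFDerivWithinAt.fibre_unique`) and smoothness of `α^L` (`contMDiff_leftExtension`). The charts
used for `α^L` are centred at units, so smoothness holds also at arrows in the boundary.

The algebroid laws follow from the principle that related fields have related brackets
(`mfderiv_mlieBracket_of_related`). The field `α^L` is `t`-related to zero, so brackets stay in `ker
dt`; it is `s`-related to the anchored field, so the anchor preserves brackets; it is preserved by
left translations, so the bracket of two extensions is again an extension (`leftExtension_bracket`),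
and the Jacobi identity descends from vector fields. A functor over the identity of `X` that is a
diffeomorphism near the units relates extensions to extensions, so its differential is an
isomorphism of left algebroids (`IsLocalIso.leftAlgebroidIso`). This is applied to the inclusion of
the core, to its opposite, and to inversion, seen as a functor to the opposite groupoid.

For the core, let `g` be invertible. Translating the fibre at `u (s g)` by `g` gives an immersed
piece of fibre through `g` that is parametrized by a vector space and has tangent space `ker dt`. If
`g` were a boundary point, this piece would touch the boundary from inside, so `ker dt` would be
tangent to the boundary. As `t` restricted to the boundary is a submersion, all of `T_g C` would
then be tangent to it, which is absurd (`isInteriorPoint_of_isInverse`). Now the implicit function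
theorem solves `k h = u (t k)` for `h`, smoothly in `k` near `g`. The opposite category yields left
inverses, and the two agree, so the core is open and inversion is smooth (`eventually_isInverse`).
-/

/-- Differentiate the relation `dF (V x) = V' (F x)` along `W`, and the one for `W` along `V`. The
second derivative of `F` is symmetric at a point in the closure of the interior of `S`, so it
cancels in the difference. -/
theorem fderivWithin_lieBracketWithin_of_related {S : Set E} {T : Set E'} {F : E → E'} {e : E}
    {V W : E → E} {V' W' : E' → E'} (hF : ContDiffWithinAt ℝ 2 F S e) (hS : UniqueDiffOn ℝ S)
    (he : e ∈ S) (he' : e ∈ closure (interior S)) (hFS : MapsTo F S T)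
    (hV : DifferentiableWithinAt ℝ V S e) (hW : DifferentiableWithinAt ℝ W S e)
    (hV' : DifferentiableWithinAt ℝ V' T (F e)) (hW' : DifferentiableWithinAt ℝ W' T (F e))
    (hVV : ∀ᶠ x in 𝓝[S] e, fderivWithin ℝ F S x (V x) = V' (F x))
    (hWW : ∀ᶠ x in 𝓝[S] e, fderivWithin ℝ F S x (W x) = W' (F x)) :
    fderivWithin ℝ F S e (lieBracketWithin ℝ V W S e) = lieBracketWithin ℝ V' W' T (F e) := by
  have hFd : HasFDerivWithinAt F (fderivWithin ℝ F S e) S e :=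
    (hF.differentiableWithinAt two_ne_zero).hasFDerivWithinAt
  have key : ∀ {U : E → E} {U' : E' → E'}, DifferentiableWithinAt ℝ U' T (F e) →
      (∀ᶠ x in 𝓝[S] e, fderivWithin ℝ F S x (U x) = U' (F x)) →
      fderivWithin ℝ (fun x => fderivWithin ℝ F S x (U x)) S e =
        (fderivWithin ℝ U' T (F e)).comp (fderivWithin ℝ F S e) := fun {U U'} hU' h =>
    ((hU'.hasFDerivWithinAt.comp e hFd hFS).congr_of_eventuallyEq h
      (h.self_of_nhdsWithin he)).fderivWithin (hS e he)
  rw [fderivWithin_apply_lieBracket hF (by simp) hS he' he hW hV, key hW' hWW, key hV' hVV]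
  simp only [ContinuousLinearMap.comp_apply, lieBracketWithin,
    hVV.self_of_nhdsWithin he, hWW.self_of_nhdsWithin he]

/-- The derivatives of a chart and of its inverse are mutually inverse. Pullbacks thus become
pushforwards, to which the chain rule applies. -/
theorem inverse_mfderivWithin_extChartAt_symm [IsManifold I ∞ M] {x y : M}
    (hy : y ∈ (extChartAt I x).source) (V : ∀ x : M, TangentSpace I x) :
    mpullbackWithin 𝓘(ℝ, E) I (extChartAt I x).symm V (range I) (extChartAt I x y) =
      mfderiv I 𝓘(ℝ, E) (extChartAt I x) y (V y) := by
  have : IsManifold I 1 M := .of_le (n := ∞) (mod_cast le_top)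
  rw [mpullbackWithin_apply, ContinuousLinearMap.inverse_eq
    (mfderivWithin_extChartAt_symm_comp_mfderiv_extChartAt ((extChartAt I x).map_source hy))
    (mfderiv_extChartAt_comp_mfderivWithin_extChartAt_symm ((extChartAt I x).map_source hy)),
    (extChartAt I x).left_inv hy]

theorem isManifold_one [h : IsManifold I ∞ M] : IsManifold I 1 M := .of_le (mod_cast le_top : (1 : ℕ∞ω) ≤ ∞)

theorem isManifold_two [h : IsManifold I ∞ M] : IsManifold I 2 M :=
  .of_le (show ((2 : ℕ∞) : ℕ∞ω) ≤ ∞ from mod_cast le_top)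

/-- The derivative of the preferred chart at its own base point is the identity, so the bracket
needs no correction factor there. -/
theorem mlieBracket_eq_lieBracketWithin [IsManifold I ∞ M] (V W : ∀ x : M, TangentSpace I x)
    (x₀ : M) :
    mlieBracket I V W x₀ = (lieBracketWithin ℝ
      (mpullbackWithin 𝓘(ℝ, E) I (extChartAt I x₀).symm V (range I))
      (mpullbackWithin 𝓘(ℝ, E) I (extChartAt I x₀).symm W (range I)) (range I)
      (extChartAt I x₀ x₀) : E) := by
  have : IsManifold I 1 M := isManifold_one
  rw [← mlieBracketWithin_univ, mlieBracketWithin_apply, mfderiv_extChartAt_self, preimage_univ,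
    univ_inter]
  exact DFunLike.congr_fun (ContinuousLinearMap.inverse_id (R := ℝ) (M := E)) _

theorem mfderiv_eq_fderivWithin {f : M → N} {x : M} (h : MDifferentiableAt I J f x) :
    mfderiv I J f x = (fderivWithin ℝ (writtenInExtChartAt I J x f) (range I)
      (extChartAt I x x) : E →L[ℝ] E') := by
  unfold mfderiv
  exact if_pos h

/-- Related vector fields have related brackets. -/
theorem mfderiv_mlieBracket_of_related [CompleteSpace E] [CompleteSpace E']
    [IsManifold I ∞ M] [IsManifold J ∞ N]
    {f : M → N} {x₀ : M} (hf : ContMDiffAt I J ∞ f x₀)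
    {V W : ∀ x : M, TangentSpace I x} {V' W' : ∀ x : N, TangentSpace J x}
    (hV : MDifferentiableAt I I.tangent (fun x => (⟨x, V x⟩ : TangentBundle I M)) x₀)
    (hW : MDifferentiableAt I I.tangent (fun x => (⟨x, W x⟩ : TangentBundle I M)) x₀)
    (hV' : MDifferentiableAt J J.tangent (fun x => (⟨x, V' x⟩ : TangentBundle J N)) (f x₀))
    (hW' : MDifferentiableAt J J.tangent (fun x => (⟨x, W' x⟩ : TangentBundle J N)) (f x₀))
    (hVV : ∀ᶠ x in 𝓝 x₀, mfderiv I J f x (V x) = V' (f x))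
    (hWW : ∀ᶠ x in 𝓝 x₀, mfderiv I J f x (W x) = W' (f x)) :
    mfderiv I J f x₀ (mlieBracket I V W x₀) = mlieBracket J V' W' (f x₀) := by
  have : IsManifold I 1 M := isManifold_one
  have : IsManifold J 1 N := isManifold_one
  have : IsManifold I 2 M := isManifold_two
  have : IsManifold J 2 N := isManifold_two
  have hfe : ∀ᶠ x in 𝓝 x₀, MDifferentiableAt I J f x := by
    have h1 : ContMDiffAt I J 1 f x₀ := hf.of_le (mod_cast le_top)
    filter_upwards [(contMDiffAt_iff_contMDiffAt_nhds (by simp)).1 h1] with x hx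
    exact hx.mdifferentiableAt one_ne_zero
  set φ := extChartAt I x₀ with hφ
  set ψ := extChartAt J (f x₀) with hψ
  have hx₀ : x₀ ∈ φ.source := mem_extChartAt_source x₀
  have hsrc : ∀ᶠ x in 𝓝 x₀, f x ∈ ψ.source ∧ x ∈ φ.source :=
    Filter.Eventually.and (hf.continuousAt.preimage_mem_nhds (extChartAt_source_mem_nhds (f x₀)))
      (extChartAt_source_mem_nhds x₀)
  set F : E → E' := ψ ∘ f ∘ φ.symm with hF
  have hF0 : F (φ x₀) = ψ (f x₀) := by simp [hF, φ.left_inv hx₀]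
  have key : ∀ {U : ∀ x : M, TangentSpace I x} {U' : ∀ x : N, TangentSpace J x},
      (∀ᶠ x in 𝓝 x₀, mfderiv I J f x (U x) = U' (f x)) →
      ∀ᶠ e in 𝓝[range I] (φ x₀), fderivWithin ℝ F (range I) e
        (mpullbackWithin 𝓘(ℝ, E) I φ.symm U (range I) e) =
        mpullbackWithin 𝓘(ℝ, E') J ψ.symm U' (range J) (F e) := by
    intro U U' h
    -- Points of `range I` near `φ x₀` are the `φ y` with `y` near `x₀`, so the relation has to be
    -- checked only at such points.
    rw [← map_extChartAt_nhds, Filter.eventually_map]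
    filter_upwards [h, hfe, hsrc, hsrc.eventually_nhds] with y hy hfy ⟨hy1, hy2⟩ hyn
    have hFy : F (φ y) = ψ (f y) := by simp [hF, φ.left_inv hy2]
    rw [hFy, inverse_mfderivWithin_extChartAt_symm hy1, inverse_mfderivWithin_extChartAt_symm hy2,
      ← hy]
    have hφd : HasMFDerivAt I 𝓘(ℝ, E) φ y (mfderiv I 𝓘(ℝ, E) φ y) :=
      (mdifferentiableAt_extChartAt (by simpa [hφ] using hy2)).hasMFDerivAt
    have hψd : HasMFDerivAt J 𝓘(ℝ, E') ψ (f y) (mfderiv J 𝓘(ℝ, E') ψ (f y)) :=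
      (mdifferentiableAt_extChartAt (by simpa [hψ] using hy1)).hasMFDerivAt
    have hFd : HasMFDerivWithinAt 𝓘(ℝ, E) 𝓘(ℝ, E') F (range I) (φ y)
        (mfderivWithin 𝓘(ℝ, E) 𝓘(ℝ, E') F (range I) (φ y)) := by
      apply MDifferentiableWithinAt.hasMFDerivWithinAt
      exact MDifferentiableAt.comp_mdifferentiableWithinAt_of_eq (I' := I) (y := y) (φ y)
        (g := ψ ∘ f) (hψd.mdifferentiableAt.comp y hfy)
        (mdifferentiableWithinAt_extChartAt_symm (φ.map_source hy2)) (φ.left_inv hy2)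
    have h1 := hFd.comp y hφd.hasMFDerivWithinAt (s := univ)
      (fun z _ => by simp [hφ])
    rw [hasMFDerivWithinAt_univ] at h1
    have h2 := (hψd.comp y hfy.hasMFDerivAt)
    have h3 := hasMFDerivAt_unique h1 (h2.congr_of_eventuallyEq (by
      filter_upwards [hyn] with z hz
      simp [hF, φ.left_inv hz.2]))
    rw [← mfderivWithin_eq_fderivWithin]
    exact DFunLike.congr_fun h3 (U y)
  have hd : ∀ {U : ∀ x : M, TangentSpace I x},
      MDifferentiableAt I I.tangent (fun x => (⟨x, U x⟩ : TangentBundle I M)) x₀ →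
      DifferentiableWithinAt ℝ (mpullbackWithin 𝓘(ℝ, E) I φ.symm U (range I)) (range I) (φ x₀) :=
    fun {U} h => by
      have := (mdifferentiableWithinAt_univ.2
        h).differentiableWithinAt_mpullbackWithin_vectorField
      rwa [preimage_univ, univ_inter] at this
  have hd' : ∀ {U : ∀ x : N, TangentSpace J x},
      MDifferentiableAt J J.tangent (fun x => (⟨x, U x⟩ : TangentBundle J N)) (f x₀) →
      DifferentiableWithinAt ℝ (mpullbackWithin 𝓘(ℝ, E') J ψ.symm U (range J)) (range J)
        (F (φ x₀)) := fun {U} h => by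
      rw [hF0]
      have := (mdifferentiableWithinAt_univ.2
        h).differentiableWithinAt_mpullbackWithin_vectorField
      rwa [preimage_univ, univ_inter] at this
  have hmem : φ x₀ ∈ range I := by simp [hφ]
  have main := fderivWithin_lieBracketWithin_of_related (T := range J) (F := F)
    (((contMDiffAt_iff.1 hf).2).of_le (show ((2 : ℕ∞) : ℕ∞ω) ≤ ∞ from mod_cast le_top))
    I.uniqueDiffOn hmem (I.range_subset_closure_interior hmem) (fun z _ => by simp [hF, hψ])
    (hd hV) (hd hW) (hd' hV') (hd' hW') (key hVV) (key hWW)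
  rw [hF0] at main
  rw [mlieBracket_eq_lieBracketWithin, mlieBracket_eq_lieBracketWithin,
    mfderiv_eq_fderivWithin hfe.self_of_nhds]
  exact main
end Related

end

/-! ### The inverse function theorem and smooth dependence of derivatives. -/

section

section Calculus
variable {E H M E' H' N : Type*} [NormedAddCommGroup E] [NormedSpace ℝ E] [TopologicalSpace H]
  {I : ModelWithCorners ℝ E H} [TopologicalSpace M] [ChartedSpace H M]
  [NormedAddCommGroup E'] [NormedSpace ℝ E'] [TopologicalSpace H']
  {J : ModelWithCorners ℝ E' H'} [TopologicalSpace N] [ChartedSpace H' N]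

/-- The inverse function theorem at an interior point of a manifold. -/
theorem exists_local_inverse [CompleteSpace E] [IsManifold I ∞ M] {f : M → E'} {p : M}
    (hp : I.IsInteriorPoint p) (hf : ∀ᶠ x in 𝓝 p, ContMDiffAt I 𝓘(ℝ, E') ∞ f x)
    [CompleteSpace E']
    (hb : Function.Bijective (mfderiv I 𝓘(ℝ, E') f p)) :
    ∃ r : E' → M, r (f p) = p ∧ (∀ᶠ y in 𝓝 (f p), ContMDiffAt 𝓘(ℝ, E') I ∞ r y) ∧
      (∀ᶠ y in 𝓝 (f p), f (r y) = y) ∧ ∀ᶠ x in 𝓝 p, r (f x) = x := by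
  set φ := extChartAt I p with hφ
  -- This is where interiority enters: the coordinate expression of `f` is defined on a full
  -- neighbourhood, and the theorem for vector spaces applies.
  have hrange : range I ∈ 𝓝 (φ p) := range_mem_nhds_isInteriorPoint hp
  have hpp : φ.symm (φ p) = p := φ.left_inv (mem_extChartAt_source p)
  have htgt : φ.target ∈ 𝓝 (φ p) := by
    rw [← nhdsWithin_eq_nhds.2 hrange]
    exact extChartAt_target_mem_nhdsWithin p
  have hsymm : ∀ᶠ e in 𝓝 (φ p), ContMDiffAt 𝓘(ℝ, E) I ∞ φ.symm e := by
    filter_upwards [htgt, eventually_mem_nhds_iff.2 hrange] with e he he'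
    exact (contMDiffWithinAt_extChartAt_symm_range p he).contMDiffAt he'
  have hcs : Filter.Tendsto φ.symm (𝓝 (φ p)) (𝓝 p) := by
    have := continuousAt_extChartAt_symm (I := I) p
    rwa [ContinuousAt, extChartAt_to_inv] at this
  set F : E → E' := f ∘ φ.symm with hF
  have hFp : F (φ p) = f p := by simp [hF, hpp]
  have hFs : ∀ᶠ e in 𝓝 (φ p), ContDiffAt ℝ ∞ F e := by
    filter_upwards [hsymm, hcs.eventually hf] with e he he'
    exact contMDiffAt_iff_contDiffAt.1 (ContMDiffAt.comp e he' he)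
  have hfd : mfderiv I 𝓘(ℝ, E') f p = (fderiv ℝ F (φ p) : E →L[ℝ] E') := by
    rw [mfderiv_eq_fderivWithin (hf.self_of_nhds.mdifferentiableAt (by simp))]
    exact fderivWithin_of_mem_nhds hrange
  rw [hfd] at hb
  have hb' : Function.Bijective (fderiv ℝ F (φ p) : E →L[ℝ] E') := hb
  set L : E ≃L[ℝ] E' := ContinuousLinearEquiv.ofBijective (fderiv ℝ F (φ p))
    (LinearMap.ker_eq_bot.2 hb'.1) (LinearMap.range_eq_top.2 hb'.2) with hL
  have hLd : HasFDerivAt F (L : E →L[ℝ] E') (φ p) := by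
    rw [hL, ContinuousLinearEquiv.coe_ofBijective]
    exact (hFs.self_of_nhds.differentiableAt (by simp)).hasFDerivAt
  set ι := hFs.self_of_nhds.toOpenPartialHomeomorph F hLd (by simp) with hι
  have hιF : (ι : E → E') = F := rfl
  have hpι : φ p ∈ ι.source := hFs.self_of_nhds.mem_toOpenPartialHomeomorph_source hLd (by simp)
  have hιp : ι.symm (f p) = φ p := by rw [← hFp, ← hιF]; exact ι.left_inv hpι
  have hfp : f p ∈ ι.target := by rw [← hFp, ← hιF]; exact ι.map_source hpι
  have hιc : Filter.Tendsto ι.symm (𝓝 (f p)) (𝓝 (φ p)) := by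
    have := ι.continuousAt_symm hfp
    rwa [ContinuousAt, hιp] at this
  -- Invertible operators form an open set, so the derivative stays invertible nearby. This makes
  -- the inverse smooth on a neighbourhood and not only at one point.
  have hinv : ∀ᶠ e in 𝓝 (φ p), ∃ L' : E ≃L[ℝ] E', (L' : E →L[ℝ] E') = fderiv ℝ F e := by
    have hc : ContinuousAt (fderiv ℝ F) (φ p) :=
      (hFs.self_of_nhds.fderiv_right (m := 0) (by simp)).continuousAt
    have h := ContinuousLinearEquiv.nhds L
    rw [hL, ContinuousLinearEquiv.coe_ofBijective] at h
    exact hc.preimage_mem_nhds h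
  refine ⟨φ.symm ∘ ι.symm, by simp [hιp, hpp], ?_, ?_, ?_⟩
  · filter_upwards [ι.open_target.mem_nhds hfp, hιc.eventually hsymm, hιc.eventually hFs,
      hιc.eventually hinv] with y hy h1 h2 ⟨L', h3⟩
    refine ContMDiffAt.comp y h1 (contMDiffAt_iff_contDiffAt.2 ?_)
    refine ι.contDiffAt_symm hy (f₀' := L') ?_ h2
    rw [h3]
    exact (h2.differentiableAt (by simp)).hasFDerivAt
  · filter_upwards [ι.open_target.mem_nhds hfp] with y hy
    exact ι.right_inv hy
  · have hc : Filter.Tendsto φ (𝓝 p) (𝓝 (φ p)) := continuousAt_extChartAt p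
    filter_upwards [extChartAt_source_mem_nhds (I := I) p,
      hc.eventually (ι.open_source.mem_nhds hpι)] with x hx hx'
    have h1 : ι (φ x) = f x := by
      change f (φ.symm (φ x)) = f x
      rw [φ.left_inv hx]
    have h2 := ι.left_inv hx'
    rw [h1] at h2
    simp only [Function.comp_apply, h2]
    exact φ.left_inv hx

theorem contMDiffAt_tangentMap [IsManifold I ∞ M] [IsManifold J ∞ N] {f : M → N}
    {p : TangentBundle I M}
    (hf : ∀ᶠ x in 𝓝 p.proj, ContMDiffAt I J ∞ f x) :
    ContMDiffAt I.tangent J.tangent ∞ (tangentMap I J f) p := by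
  have : IsManifold I 1 M := isManifold_one
  have : IsManifold J 1 N := isManifold_one
  obtain ⟨s, hs, hso, hps⟩ := eventually_nhds_iff.1 hf
  have h1 : ContMDiffOn I J ∞ f s := fun x hx => (hs x hx).contMDiffWithinAt
  have h2 := h1.contMDiffOn_tangentMapWithin (m := ∞) (by simp) hso.uniqueMDiffOn
  have ho : IsOpen (Bundle.TotalSpace.proj ⁻¹' s : Set (TangentBundle I M)) :=
    hso.preimage (FiberBundle.continuous_proj E (TangentSpace I))
  refine ((h2 p hps).contMDiffAt (ho.mem_nhds hps)).congr_of_eventuallyEq ?_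
  filter_upwards [ho.mem_nhds hps] with q hq
  simp only [tangentMapWithin, tangentMap, mfderivWithin_of_mem_nhds (hso.mem_nhds hq)]

variable {K : Type*} [NormedAddCommGroup K] [NormedSpace ℝ K]
  {E₀ H₀ Y : Type*} [NormedAddCommGroup E₀] [NormedSpace ℝ E₀] [TopologicalSpace H₀]
  {I₀ : ModelWithCorners ℝ E₀ H₀} [TopologicalSpace Y] [ChartedSpace H₀ Y]

theorem contMDiffAt_mk_model_space {b c : Y → K} {y₀ : Y}
    (hb : ContMDiffAt I₀ 𝓘(ℝ, K) ∞ b y₀) (hc : ContMDiffAt I₀ 𝓘(ℝ, K) ∞ c y₀) :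
    ContMDiffAt I₀ 𝓘(ℝ, K).tangent ∞
      (fun y => (⟨b y, c y⟩ : TangentBundle 𝓘(ℝ, K) K)) y₀ := by
  refine Bundle.contMDiffAt_totalSpace.2 ⟨hb, ?_⟩
  simp only [trivializationAt_model_space_apply]
  exact hc

theorem mfderiv_snd_slice {S : M × K → N} {p : M × K}
    (hS : MDifferentiableAt (I.prod 𝓘(ℝ, K)) J S p) (v : K) :
    mfderiv 𝓘(ℝ, K) J (fun k => S (p.1, k)) p.2 v =
      mfderiv (I.prod 𝓘(ℝ, K)) J S p ((0 : E), v) := by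
  have h1 : HasMFDerivAt 𝓘(ℝ, K) (I.prod 𝓘(ℝ, K)) (fun k : K => (p.1, k)) p.2
      (mfderiv 𝓘(ℝ, K) (I.prod 𝓘(ℝ, K)) (fun k : K => (p.1, k)) p.2) :=
    (mdifferentiableAt_const.prodMk mdifferentiableAt_id).hasMFDerivAt
  have h2 := (HasMFDerivAt.comp p.2 (f := fun k : K => (p.1, k)) hS.hasMFDerivAt h1).mfderiv
  rw [mfderiv_prod_right] at h2
  exact DFunLike.congr_fun h2 v

/-- Smoothness of the partial derivative in the direction of a vector space. -/
theorem contMDiffAt_partialDeriv_snd [IsManifold I ∞ M] [IsManifold J ∞ N] {S : M × K → N}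
    {a : Y → M} {b c : Y → K} {y₀ : Y}
    (hS : ∀ᶠ z in 𝓝 (a y₀, b y₀), ContMDiffAt (I.prod 𝓘(ℝ, K)) J ∞ S z)
    (ha : ContMDiffAt I₀ I ∞ a y₀)
    (hb : ContMDiffAt I₀ 𝓘(ℝ, K) ∞ b y₀) (hc : ContMDiffAt I₀ 𝓘(ℝ, K) ∞ c y₀) :
    ContMDiffAt I₀ J.tangent ∞ (fun y => (⟨S (a y, b y),
      mfderiv 𝓘(ℝ, K) J (fun k => S (a y, k)) (b y) (c y)⟩ : TangentBundle J N)) y₀ := by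
  have : IsManifold I 1 M := isManifold_one
  -- The partial derivative is the tangent map of `S` at the vector `(0, c y)`, which is assembled
  -- from the zero section over `a` and from `c`.
  have h0 : ContMDiffAt I₀ I.tangent ∞ (fun y => (⟨a y, 0⟩ : TangentBundle I M)) y₀ :=
    (Bundle.contMDiff_zeroSection ℝ (TangentSpace I : M → Type _)).contMDiffAt.comp y₀ ha
  have h1 : ContMDiffAt I₀ (I.prod 𝓘(ℝ, K)).tangent ∞
      (fun y => (⟨(a y, b y), ((0 : E), c y)⟩ : TangentBundle (I.prod 𝓘(ℝ, K)) (M × K))) y₀ :=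
    (contMDiff_equivTangentBundleProd_symm (I := I) (M := M) (I' := 𝓘(ℝ, K))
      (M' := K)).contMDiffAt.comp y₀ (h0.prodMk (contMDiffAt_mk_model_space hb hc))
  have h2 := ContMDiffAt.comp y₀ (contMDiffAt_tangentMap (p := ⟨(a y₀, b y₀), ((0 : E), c y₀)⟩)
    hS) h1
  refine h2.congr_of_eventuallyEq ?_
  filter_upwards [(ha.continuousAt.prodMk hb.continuousAt).eventually hS] with y hy
  simp only [Function.comp_apply, tangentMap]
  rw [mfderiv_snd_slice (p := (a y, b y)) (hy.mdifferentiableAt (by simp))]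

end Calculus

end

/-! ### Charts adapted to the fibres of a submersion. -/

section

section FibreChart

/-- Take a projection onto `ker A` followed by linear coordinates on it. Then `A.prod π` is
injective, and the dimensions agree. -/
theorem exists_complement_coordinates {E F : Type*} [NormedAddCommGroup E] [NormedSpace ℝ E]
    [FiniteDimensional ℝ E] [NormedAddCommGroup F] [NormedSpace ℝ F] [FiniteDimensional ℝ F]
    {r : ℕ} (hr : Module.finrank ℝ E = Module.finrank ℝ F + r) {A : E →L[ℝ] F}
    (hA : Function.Surjective A) :
    ∃ π : E →L[ℝ] (Fin r → ℝ), Function.Bijective (A.prod π) := by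
  have hk : Module.finrank ℝ (LinearMap.ker A.toLinearMap) = r := by
    have h1 := A.toLinearMap.finrank_range_add_finrank_ker
    rw [LinearMap.range_eq_top.2 hA, finrank_top] at h1
    omega
  obtain ⟨P, hP⟩ := (LinearMap.ker A.toLinearMap).subtype.exists_leftInverse_of_injective
    (Submodule.ker_subtype _)
  let e : LinearMap.ker A.toLinearMap ≃ₗ[ℝ] (Fin r → ℝ) :=
    LinearEquiv.ofFinrankEq _ _ (by simp [hk])
  refine ⟨LinearMap.toContinuousLinearMap (e.toLinearMap ∘ₗ P), ?_⟩
  set B := A.prod (LinearMap.toContinuousLinearMap (e.toLinearMap ∘ₗ P)) with hB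
  have hinj : Function.Injective B.toLinearMap := by
    rw [← LinearMap.ker_eq_bot, LinearMap.ker_eq_bot']
    intro v hv
    have hv' : B v = 0 := hv
    simp only [hB, ContinuousLinearMap.prod_apply, Prod.mk_eq_zero] at hv'
    have h2 : P v = 0 := e.map_eq_zero_iff.1 hv'.2
    have h3 := LinearMap.congr_fun hP ⟨v, hv'.1⟩
    have h4 : P v = ⟨v, hv'.1⟩ := h3
    rw [h2] at h4
    exact (congrArg Subtype.val h4).symm
  exact ⟨hinj, (LinearMap.injective_iff_surjective_of_finrank_eq_finrank
    (by simp [hr])).1 hinj⟩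

/-- Base points will agree only through equations such as `m g (u (s g)) = g`. Making the equation a
hypothesis avoids rewriting inside tangent spaces. -/
theorem HasMFDerivWithinAt.comp_of_eq' {E H M E' H' N E'' H'' P : Type*} [NormedAddCommGroup E]
    [NormedSpace ℝ E] [TopologicalSpace H] {I : ModelWithCorners ℝ E H} [TopologicalSpace M]
    [ChartedSpace H M] [NormedAddCommGroup E'] [NormedSpace ℝ E'] [TopologicalSpace H']
    {I' : ModelWithCorners ℝ E' H'} [TopologicalSpace N] [ChartedSpace H' N]
    [NormedAddCommGroup E''] [NormedSpace ℝ E''] [TopologicalSpace H'']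
    {I'' : ModelWithCorners ℝ E'' H''} [TopologicalSpace P] [ChartedSpace H'' P]
    {g : N → P} {f : M → N} {s : Set M} {u : Set N} {x : M} {y : N} {D' : E' →L[ℝ] E''}
    {D : E →L[ℝ] E'} (hg : HasMFDerivWithinAt I' I'' g u y D')
    (hf : HasMFDerivWithinAt I I' f s x D) (hy : f x = y) (hs : s ⊆ f ⁻¹' u) :
    HasMFDerivWithinAt I I'' (g ∘ f) s x (D'.comp D : E →L[ℝ] E'') := by
  subst hy
  exact hg.comp x hf hs

variable {E H C : Type*} (F : Type*) {X : Type*} [NormedAddCommGroup E] [NormedSpace ℝ E] [TopologicalSpace H]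
  (I : ModelWithCorners ℝ E H) [TopologicalSpace C] [ChartedSpace H C]
  [NormedAddCommGroup F] [NormedSpace ℝ F] [TopologicalSpace X] [ChartedSpace F X]

/-- Local coordinates at `p` in which a map `t : C → X` is a projection: `σ` parametrizes the
fibres of `t` near `p`, and `κ` is the coordinate along the fibres. -/
structure FibreChart (t : C → X) (p : C) (r : ℕ) where
  σ : X × (Fin r → ℝ) → C
  κ : C → (Fin r → ℝ)
  κ_self : κ p = 0
  σ_self : σ (t p, 0) = p
  smooth_σ : ∀ᶠ z in 𝓝 (t p, (0 : Fin r → ℝ)),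
    ContMDiffAt (𝓘(ℝ, F).prod 𝓘(ℝ, Fin r → ℝ)) I ∞ σ z
  smooth_κ : ∀ᶠ g in 𝓝 p, ContMDiffAt I 𝓘(ℝ, Fin r → ℝ) ∞ κ g
  t_σ : ∀ᶠ z in 𝓝 (t p, (0 : Fin r → ℝ)), t (σ z) = z.1
  κ_σ : ∀ᶠ z in 𝓝 (t p, (0 : Fin r → ℝ)), κ (σ z) = z.2
  σ_κ : ∀ᶠ g in 𝓝 p, σ (t g, κ g) = g

variable {F I}

/-- Complete `dt` at `p` to a linear isomorphism by some `π`. In charts, `g ↦ (t g, π g)` is then a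
local diffeomorphism at `p`, and its local inverse is `σ`. -/
theorem nonempty_fibreChart [FiniteDimensional ℝ E] [FiniteDimensional ℝ F] [IsManifold I ∞ C]
    [IsManifold 𝓘(ℝ, F) ∞ X] {t : C → X} (ht : ContMDiff I 𝓘(ℝ, F) ∞ t) {p : C}
    (hp : I.IsInteriorPoint p) (hs : Function.Surjective (mfderiv I 𝓘(ℝ, F) t p)) {r : ℕ}
    (hr : Module.finrank ℝ E = Module.finrank ℝ F + r) : Nonempty (FibreChart F I t p r) := by
  have : IsManifold I 1 C := isManifold_one
  have : IsManifold 𝓘(ℝ, F) 1 X := isManifold_one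
  have : CompleteSpace E := FiniteDimensional.complete ℝ E
  have : CompleteSpace F := FiniteDimensional.complete ℝ F
  obtain ⟨π, hπ⟩ := exists_complement_coordinates hr (A := mfderiv I 𝓘(ℝ, F) t p) hs
  set φ := extChartAt I p with hφ
  set χ := extChartAt 𝓘(ℝ, F) (t p) with hχ
  have hpφ : p ∈ φ.source := mem_extChartAt_source p
  have hpχ : t p ∈ χ.source := mem_extChartAt_source (t p)
  set f : C → F × (Fin r → ℝ) := fun g => (χ (t g), π (φ g)) with hf
  have htc : Filter.Tendsto t (𝓝 p) (𝓝 (t p)) := ht.continuous.continuousAt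
  have hχs : ∀ᶠ x in 𝓝 (t p), ContMDiffAt 𝓘(ℝ, F) 𝓘(ℝ, F) ∞ χ x := by
    filter_upwards [chart_source_mem_nhds F (t p)] with x hx
    exact contMDiffAt_extChartAt' hx
  have hφs : ∀ᶠ g in 𝓝 p, ContMDiffAt I 𝓘(ℝ, E) ∞ φ g := by
    filter_upwards [chart_source_mem_nhds H p] with g hg
    exact contMDiffAt_extChartAt' hg
  have hπφ : ∀ᶠ g in 𝓝 p, ContMDiffAt I 𝓘(ℝ, Fin r → ℝ) ∞ (fun g => π (φ g)) g := by
    filter_upwards [hφs] with g hg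
    exact π.contMDiff.contMDiffAt.comp g hg
  have hfs : ∀ᶠ g in 𝓝 p, ContMDiffAt I 𝓘(ℝ, F × (Fin r → ℝ)) ∞ f g := by
    filter_upwards [hπφ, htc.eventually hχs] with g hg hg'
    exact ContMDiffAt.prodMk_space (hg'.comp g ht.contMDiffAt) hg
  have hfd : HasMFDerivAt I 𝓘(ℝ, F × (Fin r → ℝ)) f p
      (ContinuousLinearMap.prod (mfderiv I 𝓘(ℝ, F) t p : E →L[ℝ] F) π) := by
    have h1 : HasMFDerivAt 𝓘(ℝ, F) 𝓘(ℝ, F) χ (t p) (ContinuousLinearMap.id ℝ F) := by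
      have := (mdifferentiableAt_extChartAt (I := 𝓘(ℝ, F))
        (ChartedSpace.mem_chart_source (H := F) (t p))).hasMFDerivAt
      rwa [mfderiv_extChartAt_self] at this
    have h2 : HasMFDerivAt I 𝓘(ℝ, E) φ p (ContinuousLinearMap.id ℝ E) := by
      have := (mdifferentiableAt_extChartAt (I := I)
        (ChartedSpace.mem_chart_source (H := H) p)).hasMFDerivAt
      rwa [mfderiv_extChartAt_self] at this
    have h3 := h1.comp p (ht.mdifferentiable (by simp) p).hasMFDerivAt
    have h4 := (π.hasMFDerivAt (x := φ p)).comp p h2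
    exact ⟨h3.1.prodMk h4.1, h3.2.prodMk h4.2⟩
  obtain ⟨ρ, hρp, hρs, hfρ, hρf⟩ := exists_local_inverse hp hfs (by rw [hfd.mfderiv]; exact hπ)
  -- Translating by `w₀` normalizes the fibre coordinate to vanish at `p`.
  set w₀ := π (φ p) with hw₀
  set j : X × (Fin r → ℝ) → F × (Fin r → ℝ) := fun z => (χ z.1, z.2 + w₀) with hj
  have hj0 : j (t p, 0) = f p := by simp [hj, hf, hw₀]
  have hjs : ∀ᶠ z in 𝓝 (t p, (0 : Fin r → ℝ)),
      ContMDiffAt (𝓘(ℝ, F).prod 𝓘(ℝ, Fin r → ℝ)) 𝓘(ℝ, F × (Fin r → ℝ)) ∞ j z := by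
    filter_upwards [(continuousAt_fst (p := (t p, (0 : Fin r → ℝ)))).eventually hχs] with z hz
    exact ContMDiffAt.prodMk_space (hz.comp z contMDiffAt_fst)
      (contMDiffAt_snd.add contMDiffAt_const)
  have hjc : Filter.Tendsto j (𝓝 (t p, (0 : Fin r → ℝ))) (𝓝 (f p)) := by
    rw [← hj0]; exact hjs.self_of_nhds.continuousAt
  have hσs : ∀ᶠ z in 𝓝 (t p, (0 : Fin r → ℝ)),
      ContMDiffAt (𝓘(ℝ, F).prod 𝓘(ℝ, Fin r → ℝ)) I ∞ (ρ ∘ j) z := by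
    filter_upwards [hjs, hjc.eventually hρs] with z h1 h2
    exact h2.comp z h1
  have hσ0 : (ρ ∘ j) (t p, 0) = p := by simp [hj0, hρp]
  have hσc : Filter.Tendsto (ρ ∘ j) (𝓝 (t p, (0 : Fin r → ℝ))) (𝓝 p) := by
    have := hσs.self_of_nhds.continuousAt
    rwa [ContinuousAt, hσ0] at this
  refine ⟨{ σ := ρ ∘ j, κ := fun g => π (φ g) - w₀, κ_self := sub_self w₀, σ_self := hσ0,
            smooth_σ := hσs, smooth_κ := ?_, t_σ := ?_, κ_σ := ?_, σ_κ := ?_ }⟩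
  · filter_upwards [hπφ] with g hg
    exact hg.sub contMDiffAt_const
  -- The charts of `X` agree on `t (σ z)` and `z.1`. Both points must lie in the chart domain to
  -- conclude that they are equal.
  · filter_upwards [hjc.eventually hfρ, (htc.comp hσc).eventually (extChartAt_source_mem_nhds (I := 𝓘(ℝ, F)) (t p)),
      (continuousAt_fst (p := (t p, (0 : Fin r → ℝ)))).eventually
        (extChartAt_source_mem_nhds (I := 𝓘(ℝ, F)) (t p))] with z h1 h2 h3
    exact χ.injOn h2 h3 (congrArg Prod.fst h1)
  · filter_upwards [hjc.eventually hfρ] with z h1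
    have h2 : π (φ (ρ (j z))) = z.2 + w₀ := congrArg Prod.snd h1
    simp [h2]
  · filter_upwards [hρf] with g hg
    have h2 : j (t g, π (φ g) - w₀) = f g := by simp [hj, hf, hw₀]
    simp only [Function.comp_apply, h2, hg]

namespace FibreChart

variable {t : C → X} {p : C} {r : ℕ} (c : FibreChart F I t p r)

theorem eventually_mem_source (ht : ContinuousAt t p) : ∀ᶠ g in 𝓝 p,
    ContMDiffAt (𝓘(ℝ, F).prod 𝓘(ℝ, Fin r → ℝ)) I ∞ c.σ (t g, c.κ g) ∧
    ContMDiffAt I 𝓘(ℝ, Fin r → ℝ) ∞ c.κ g ∧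
    (∀ᶠ z in 𝓝 (t g, c.κ g), t (c.σ z) = z.1) ∧
    (∀ᶠ z in 𝓝 (t g, c.κ g), c.κ (c.σ z) = z.2) ∧
    (∀ᶠ h in 𝓝 g, c.σ (t h, c.κ h) = h) := by
  have hc : Filter.Tendsto (fun g => (t g, c.κ g)) (𝓝 p) (𝓝 (t p, 0)) := by
    have := ht.prodMk c.smooth_κ.self_of_nhds.continuousAt
    rwa [ContinuousAt, c.κ_self] at this
  filter_upwards [hc.eventually c.smooth_σ, c.smooth_κ, hc.eventually c.t_σ.eventually_nhds,
    hc.eventually c.κ_σ.eventually_nhds, c.σ_κ.eventually_nhds] with g h1 h2 h3 h4 h5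
  exact ⟨h1, h2, h3, h4, h5⟩

/-- The coordinate `κ` and the parametrization `σ` have inverse derivatives along the fibres. -/
theorem eventually_mfderiv_σ (ht : ContMDiff I 𝓘(ℝ, F) ∞ t) : ∀ᶠ g in 𝓝 p,
    (∀ v : TangentSpace I g, mfderiv I 𝓘(ℝ, F) t g v = 0 →
      @Eq E (mfderiv 𝓘(ℝ, Fin r → ℝ) I (fun w => c.σ (t g, w)) (c.κ g)
        (mfderiv I 𝓘(ℝ, Fin r → ℝ) c.κ g v)) v) := by
  filter_upwards [c.eventually_mem_source ht.continuous.continuousAt] with g ⟨h1, h2, h3, h4, h5⟩ v hv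
  have hκ := h2.mdifferentiableAt (by simp)
  have ht' := ht.mdifferentiable (by simp) g
  have hσ := h1.mdifferentiableAt (by simp)
  have h6 : HasMFDerivAt I (𝓘(ℝ, F).prod 𝓘(ℝ, Fin r → ℝ)) (fun g => (t g, c.κ g)) g _ :=
    ht'.hasMFDerivAt.prodMk hκ.hasMFDerivAt
  have h7 := (HasMFDerivAt.comp g (f := fun g => (t g, c.κ g)) hσ.hasMFDerivAt h6)
  have h8 := hasMFDerivAt_unique (h7.congr_of_eventuallyEq
    (f₁ := id) (by filter_upwards [h5] with h hh using hh.symm)) (hasMFDerivAt_id g)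
  have h9 := DFunLike.congr_fun h8 v
  refine (mfderiv_snd_slice (p := (t g, c.κ g)) hσ (mfderiv I 𝓘(ℝ, Fin r → ℝ) c.κ g v)).trans ?_
  -- As `dt v = 0`, the vector `(0, dκ v)` is the image of `v` under the derivative of `(t, κ)`,
  -- which `dσ` inverts.
  have h10 : ((0 : F), mfderiv I 𝓘(ℝ, Fin r → ℝ) c.κ g v) = (mfderiv I 𝓘(ℝ, F) t g v,
    mfderiv I 𝓘(ℝ, Fin r → ℝ) c.κ g v) := by rw [hv]; rfl
  exact (congrArg (mfderiv (𝓘(ℝ, F).prod 𝓘(ℝ, Fin r → ℝ)) I c.σ (t g, c.κ g)) h10).trans h9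

theorem eventually_slice (ht : ContMDiff I 𝓘(ℝ, F) ∞ t) : ∀ᶠ g in 𝓝 p,
    c.σ (t g, c.κ g) = g ∧ (∀ᶠ w in 𝓝 (c.κ g), t (c.σ (t g, w)) = t g) ∧
    (∀ᶠ w in 𝓝 (c.κ g), ContMDiffAt 𝓘(ℝ, Fin r → ℝ) I ∞ (fun w => c.σ (t g, w)) w) := by
  have hc : Filter.Tendsto (fun g => (t g, c.κ g)) (𝓝 p) (𝓝 (t p, 0)) := by
    have := (ht.continuous.continuousAt (x := p)).prodMk c.smooth_κ.self_of_nhds.continuousAt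
    rwa [ContinuousAt, c.κ_self] at this
  filter_upwards [c.σ_κ, hc.eventually c.t_σ.eventually_nhds,
    hc.eventually c.smooth_σ.eventually_nhds] with g h1 h2 h3
  have hs : Filter.Tendsto (fun w => (t g, w)) (𝓝 (c.κ g)) (𝓝 (t g, c.κ g)) :=
    (Continuous.prodMk_right (t g)).tendsto _
  refine ⟨h1, hs.eventually h2, ?_⟩
  filter_upwards [hs.eventually h3] with w hw
  exact ContMDiffAt.comp w hw (contMDiffAt_const.prodMk contMDiffAt_id)

variable {E' H' N : Type*} [NormedAddCommGroup E'] [NormedSpace ℝ E'] [TopologicalSpace H']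
  {J : ModelWithCorners ℝ E' H'} [TopologicalSpace N] [ChartedSpace H' N]

/-- The slice `w ↦ σ (t g, w)` stays in the fibre, so the chain rule applies to any derivative `D`
within the fibre. The left-hand side is an ordinary derivative and does not involve `D`: this yields
both uniqueness of `D` on `ker dt` and smooth dependence on parameters. -/
theorem eventually_mfderiv_comp_slice (ht : ContMDiff I 𝓘(ℝ, F) ∞ t) : ∀ᶠ g in 𝓝 p,
    ∀ (f : C → N) (D : E →L[ℝ] E'), HasMFDerivWithinAt I J f {h | t h = t g} g D →
      ∀ v : TangentSpace I g, mfderiv I 𝓘(ℝ, F) t g v = 0 →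
      @Eq E' (mfderiv 𝓘(ℝ, Fin r → ℝ) J (fun w => f (c.σ (t g, w))) (c.κ g)
        (mfderiv I 𝓘(ℝ, Fin r → ℝ) c.κ g v)) (D v) := by
  filter_upwards [c.eventually_slice ht, c.eventually_mfderiv_σ ht] with g ⟨h1, h2, h3⟩ h4 f D hD v hv
  have h5 := (h3.self_of_nhds.mdifferentiableAt (by simp)).hasMFDerivAt
  have h6 := (hD.comp_of_eq' h5.hasMFDerivWithinAt (s := {w | t (c.σ (t g, w)) = t g}) h1
    (fun w hw => hw)).hasMFDerivAt h2
  have h7 := DFunLike.congr_fun h6.mfderiv (mfderiv I 𝓘(ℝ, Fin r → ℝ) c.κ g v)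
  exact h7.trans (congrArg D (h4 v hv))

end FibreChart

theorem finrank_eq_add_of_surjective [FiniteDimensional ℝ E] [FiniteDimensional ℝ F]
    {A : E →L[ℝ] F} (hA : Function.Surjective A) :
    Module.finrank ℝ E = Module.finrank ℝ F + (Module.finrank ℝ E - Module.finrank ℝ F) := by
  have := LinearMap.finrank_le_finrank_of_surjective (f := A.toLinearMap) hA
  omega

variable {E' H' N : Type*} [NormedAddCommGroup E'] [NormedSpace ℝ E'] [TopologicalSpace H']
  {J : ModelWithCorners ℝ E' H'} [TopologicalSpace N] [ChartedSpace H' N]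

/-- Derivatives along a fibre of a submersion are unique on the vectors tangent to the fibre. -/
theorem HasMFDerivWithinAt.fibre_unique [FiniteDimensional ℝ E] [FiniteDimensional ℝ F]
    [IsManifold I ∞ C] [IsManifold 𝓘(ℝ, F) ∞ X] {t : C → X} (ht : ContMDiff I 𝓘(ℝ, F) ∞ t) {p : C}
    (hp : I.IsInteriorPoint p) (hs : Function.Surjective (mfderiv I 𝓘(ℝ, F) t p)) {x : X}
    (hx : t p = x) {f f' : C → N} (hf : EqOn f f' {h | t h = x}) {D D' : E →L[ℝ] E'}
    (hD : HasMFDerivWithinAt I J f {h | t h = x} p D)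
    (hD' : HasMFDerivWithinAt I J f' {h | t h = x} p D') {v : E}
    (hv : mfderiv I 𝓘(ℝ, F) t p v = 0) : D v = D' v := by
  subst hx
  obtain ⟨c⟩ := nonempty_fibreChart ht hp hs (finrank_eq_add_of_surjective hs)
  have key := (c.eventually_mfderiv_comp_slice (J := J) (N := N) ht).self_of_nhds
  exact (key f D hD v hv).symm.trans (key f D' (hD'.congr_of_eventuallyEq
    (eventually_nhdsWithin_of_forall fun h hh => hf hh) (hf rfl)) v hv)

end FibreChart

end

/-! ### Left-invariant extensions and the maps that relate them. -/

section

namespace ArrowCat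

section LieCategory

variable {E H C F X : Type*} [NormedAddCommGroup E] [NormedSpace ℝ E] [TopologicalSpace H]
  {I : ModelWithCorners ℝ E H} [TopologicalSpace C] [ChartedSpace H C]
  [NormedAddCommGroup F] [NormedSpace ℝ F] [TopologicalSpace X] [ChartedSpace F X]
  {𝒞 : ArrowCat C X}

namespace IsLieCategory

/-- The definition is symmetric in `s` and `t`. All statements about right algebroids and left
inverses are obtained from their mirror images in this way. -/
theorem op (h : 𝒞.IsLieCategory F I) : 𝒞.op.IsLieCategory F I where
  smooth_s := h.smooth_t
  smooth_t := h.smooth_s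
  submersion_s := h.submersion_t
  submersion_t := h.submersion_s
  smooth_u := h.smooth_u
  smooth_m := h.smooth_m.comp (contMDiff_snd.prodMk contMDiff_fst).contMDiffOn
    (fun _ hp => (Eq.symm hp : _))
  boundary_submersion_s := h.boundary_submersion_t
  boundary_submersion_t := h.boundary_submersion_s

theorem contMDiffWithinAt_m_left (h𝒞 : 𝒞.IsLieCategory F I) {g h : C} (e : 𝒞.s g = 𝒞.t h) :
    ContMDiffWithinAt I I ∞ (𝒞.m g) (𝒞.tFibre (𝒞.s g)) h :=
  (h𝒞.smooth_m (g, h) e).comp h (contMDiffWithinAt_const.prodMk contMDiffWithinAt_id)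
    (fun _ hk => (Eq.symm hk : _))

theorem hasMFDerivWithinAt_m_left (h𝒞 : 𝒞.IsLieCategory F I) (g : C) :
    HasMFDerivWithinAt I I (𝒞.m g) (𝒞.tFibre (𝒞.s g)) (𝒞.u (𝒞.s g))
      (mfderivWithin I I (𝒞.m g) (𝒞.tFibre (𝒞.s g)) (𝒞.u (𝒞.s g))) :=
  ((h𝒞.contMDiffWithinAt_m_left (𝒞.t_u _).symm).mdifferentiableWithinAt
    (by simp)).hasMFDerivWithinAt

/-- Composition of smooth maps into the arrows. -/
theorem contMDiffAt_m (h𝒞 : 𝒞.IsLieCategory F I) {E' H' N : Type*} [NormedAddCommGroup E']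
    [NormedSpace ℝ E'] [TopologicalSpace H'] {J : ModelWithCorners ℝ E' H'} [TopologicalSpace N]
    [ChartedSpace H' N] {a b : N → C} {z : N} (ha : ContMDiffAt J I ∞ a z)
    (hb : ContMDiffAt J I ∞ b z) (e : ∀ᶠ y in 𝓝 z, 𝒞.s (a y) = 𝒞.t (b y)) :
    ContMDiffAt J I ∞ (fun y => 𝒞.m (a y) (b y)) z := by
  have h1 : ContMDiffWithinAt J I ∞ (fun y => 𝒞.m (a y) (b y))
      {y | 𝒞.s (a y) = 𝒞.t (b y)} z :=
    (h𝒞.smooth_m (a z, b z) e.self_of_nhds).comp z (ha.prodMk hb).contMDiffWithinAt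
      (fun _ hk => hk)
  exact h1.contMDiffAt e

end IsLieCategory

end LieCategory

section LeftExtension

variable {E H C F X : Type*} [NormedAddCommGroup E] [NormedSpace ℝ E] [FiniteDimensional ℝ E]
  [TopologicalSpace H]
  {I : ModelWithCorners ℝ E H} [TopologicalSpace C] [ChartedSpace H C] [IsManifold I ∞ C]
  [NormedAddCommGroup F] [NormedSpace ℝ F] [FiniteDimensional ℝ F]
  [TopologicalSpace X] [ChartedSpace F X]
  [IsManifold 𝓘(ℝ, F) ∞ X] {𝒞 : ArrowCat C X} (h𝒞 : 𝒞.IsLieCategory F I)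
  (hu : ∀ x, 𝒞.u x ∈ I.interior C)
  {E' H' N : Type*} [NormedAddCommGroup E'] [NormedSpace ℝ E'] [TopologicalSpace H']
  {J : ModelWithCorners ℝ E' H'} [TopologicalSpace N] [ChartedSpace H' N]

theorem leftExtension_eq_of_s_eq (α : ∀ x, 𝒞.leftFibre F I x) {g : C} {y : X} (hy : 𝒞.s g = y) :
    @Eq E (𝒞.leftExtension F I α g)
      (mfderivWithin I I (𝒞.m g) (𝒞.tFibre y) (𝒞.u y) (α y).1) := by
  subst hy; rfl

include h𝒞 hu in
/-- At the units, derivatives along a target fibre are unique on the vectors of `A^L(C)`. -/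
theorem fibreDeriv_unique {x : X} {f f' : C → N} (hf : EqOn f f' (𝒞.tFibre x))
    {D D' : E →L[ℝ] E'} (hD : HasMFDerivWithinAt I J f (𝒞.tFibre x) (𝒞.u x) D)
    (hD' : HasMFDerivWithinAt I J f' (𝒞.tFibre x) (𝒞.u x) D') (v : 𝒞.leftFibre F I x) :
    D v.1 = D' v.1 :=
  HasMFDerivWithinAt.fibre_unique h𝒞.smooth_t (hu x) (h𝒞.submersion_t _) (𝒞.t_u x) hf hD hD' v.2

include h𝒞 hu in
-- The chain rule for `f ∘ L_g` on the fibre, where `f ∘ L_g` may be replaced by any map `f'` with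
-- the same values there. The choices of `f'` that matter are the constant `t g` for `f = t`, the
-- map `s` for `f = s`, and `L_{φ g} ∘ φ` for a functor `f = φ`.
theorem mfderiv_leftExtension_eq (α : ∀ x, 𝒞.leftFibre F I x) (g : C) {f f' : C → N}
    (hf : MDifferentiableAt I J f g)
    (hff : EqOn (f ∘ 𝒞.m g) f' (𝒞.tFibre (𝒞.s g))) {D' : E →L[ℝ] E'}
    (hD' : HasMFDerivWithinAt I J f' (𝒞.tFibre (𝒞.s g)) (𝒞.u (𝒞.s g)) D') :
    @Eq E' (mfderiv I J f g (𝒞.leftExtension F I α g)) (D' (α (𝒞.s g)).1) :=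
  fibreDeriv_unique h𝒞 hu hff
    (hf.hasMFDerivAt.hasMFDerivWithinAt (s := univ) |>.comp_of_eq' (h𝒞.hasMFDerivWithinAt_m_left g)
      (𝒞.m_u g) (subset_univ _)) hD' _

include h𝒞 hu in
theorem mfderiv_t_leftExtension (α : ∀ x, 𝒞.leftFibre F I x) (g : C) :
    mfderiv I 𝓘(ℝ, F) 𝒞.t g (𝒞.leftExtension F I α g) = 0 :=
  mfderiv_leftExtension_eq h𝒞 hu α g (f' := fun _ => 𝒞.t g)
    (h𝒞.smooth_t.mdifferentiable (by simp) g)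
    (fun k hk => 𝒞.t_m g k (Eq.symm hk)) (hasMFDerivWithinAt_const _ _ _)

include h𝒞 hu in
theorem mfderiv_s_leftExtension (α : ∀ x, 𝒞.leftFibre F I x) (g : C) :
    @Eq F (mfderiv I 𝓘(ℝ, F) 𝒞.s g (𝒞.leftExtension F I α g))
      ((𝒞.leftAlgebroid F I).anchor (𝒞.s g) (α (𝒞.s g))) :=
  mfderiv_leftExtension_eq h𝒞 hu α g (f' := 𝒞.s)
    (h𝒞.smooth_s.mdifferentiable (by simp) g)
    (fun k hk => 𝒞.s_m g k (Eq.symm hk))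
    ((h𝒞.smooth_s.mdifferentiable (by simp) _).hasMFDerivAt.hasMFDerivWithinAt)

include h𝒞 hu in
theorem leftExtension_u (α : ∀ x, 𝒞.leftFibre F I x) (x : X) :
    𝒞.leftExtension F I α (𝒞.u x) = (α x).1 := by
  have h1 := h𝒞.hasMFDerivWithinAt_m_left (𝒞.u x)
  rw [𝒞.s_u] at h1
  refine (leftExtension_eq_of_s_eq α (𝒞.s_u x)).trans ?_
  refine fibreDeriv_unique h𝒞 hu (f' := id) (fun k hk => ?_) h1 (hasMFDerivWithinAt_id _ _) (α x)
  have h2 := 𝒞.u_m k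
  rwa [show 𝒞.t k = x from hk] at h2

include h𝒞 hu in
/-- Left-invariance. -/
theorem map_leftExtension (α : ∀ x, 𝒞.leftFibre F I x) {g h : C} (e : 𝒞.s g = 𝒞.t h)
    {D : E →L[ℝ] E} (hD : HasMFDerivWithinAt I I (𝒞.m g) (𝒞.tFibre (𝒞.s g)) h D) :
    D (𝒞.leftExtension F I α h) = 𝒞.leftExtension F I α (𝒞.m g h) := by
  have h1 := hD.comp_of_eq' (h𝒞.hasMFDerivWithinAt_m_left h) (𝒞.m_u h)
    (fun k hk => (𝒞.t_m h k (Eq.symm hk)).trans e.symm)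
  have h2 := h𝒞.hasMFDerivWithinAt_m_left (𝒞.m g h)
  rw [𝒞.s_m g h e] at h2
  refine (fibreDeriv_unique h𝒞 hu (fun k hk => ?_) h1 h2 (α (𝒞.s h))).trans
    (leftExtension_eq_of_s_eq α (𝒞.s_m g h e)).symm
  -- Associativity is the identity `L_g ∘ L_h = L_{gh}` on the fibre over `s h`.
  exact (𝒞.assoc g h k e (Eq.symm hk)).symm

end LeftExtension

end ArrowCat

end

/-! ### Smoothness of left-invariant extensions. -/

section

theorem totalSpace_mk_eq {B F : Type*} {a b : B} (h : a = b) {v w : F} (hv : v = w) :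
    (⟨a, v⟩ : Bundle.TotalSpace F (fun _ : B => F)) = ⟨b, w⟩ := by
  rw [h, hv]

namespace ArrowCat

section Smoothness

variable {E H C F X : Type*} [NormedAddCommGroup E] [NormedSpace ℝ E] [FiniteDimensional ℝ E]
  [TopologicalSpace H]
  {I : ModelWithCorners ℝ E H} [TopologicalSpace C] [ChartedSpace H C] [IsManifold I ∞ C]
  [NormedAddCommGroup F] [NormedSpace ℝ F] [FiniteDimensional ℝ F]
  [TopologicalSpace X] [ChartedSpace F X]
  [IsManifold 𝓘(ℝ, F) ∞ X] {𝒞 : ArrowCat C X} (h𝒞 : 𝒞.IsLieCategory F I)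
  (hu : ∀ x, 𝒞.u x ∈ I.interior C)

include h𝒞 hu in
theorem exists_fibreChart (x : X) : Nonempty (FibreChart F I 𝒞.t (𝒞.u x)
    (Module.finrank ℝ E - Module.finrank ℝ F)) :=
  nonempty_fibreChart h𝒞.smooth_t (hu x) (h𝒞.submersion_t _)
    (finrank_eq_add_of_surjective (E := E) (F := F) (h𝒞.submersion_t (𝒞.u x)))

theorem contMDiffAt_mfderiv_section {K : Type*} [NormedAddCommGroup K] [NormedSpace ℝ K] {κ : C → K}
    {α : ∀ x, 𝒞.leftFibre F I x} {x : X} (hα : (𝒞.leftAlgebroid F I).IsSmoothAt α x)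
    (hκ : ∀ᶠ g in 𝓝 (𝒞.u x), ContMDiffAt I 𝓘(ℝ, K) ∞ κ g) :
    ContMDiffAt 𝓘(ℝ, F) 𝓘(ℝ, K) ∞
      (fun y => (mfderiv I 𝓘(ℝ, K) κ (𝒞.u y) (α y).1 : K)) x := by
  have h1 : ContMDiffAt 𝓘(ℝ, F) I.tangent ∞
    (fun y => (⟨𝒞.u y, (α y).1⟩ : TangentBundle I C)) x := hα
  have h2 := ContMDiffAt.comp x (contMDiffAt_tangentMap (p := ⟨𝒞.u x, (α x).1⟩) hκ) h1
  exact (contMDiff_snd_tangentBundle_modelSpace K 𝓘(ℝ, K)).contMDiffAt.comp x h2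

include h𝒞 hu in
-- With a fibre chart at the unit `u (s g₀)`, the vector `α^L(g)` is the partial derivative in `w`
-- of `g · σ (s g, w)`, taken at the coordinate of `u (s g)` in the direction `dκ (α (s g))`. Both
-- depend smoothly on `g`. The point `g₀` itself may lie in the boundary.
theorem contMDiff_leftExtension {α : ∀ x, 𝒞.leftFibre F I x}
    (hα : (𝒞.leftAlgebroid F I).IsSmooth α) :
    ContMDiff I I.tangent ∞ (fun g => (⟨g, 𝒞.leftExtension F I α g⟩ : TangentBundle I C)) := by
  intro g₀
  obtain ⟨r, ⟨c⟩⟩ : ∃ r, Nonempty (FibreChart F I 𝒞.t (𝒞.u (𝒞.s g₀)) r) :=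
    ⟨_, exists_fibreChart h𝒞 hu (𝒞.s g₀)⟩
  have hus : ContMDiff I I ∞ (fun g => 𝒞.u (𝒞.s g)) := h𝒞.smooth_u.comp h𝒞.smooth_s
  have hust : Filter.Tendsto (fun g => 𝒞.u (𝒞.s g)) (𝓝 g₀) (𝓝 (𝒞.u (𝒞.s g₀))) :=
    hus.continuous.continuousAt
  have hb : ContMDiffAt I 𝓘(ℝ, Fin r → ℝ) ∞ (fun g => c.κ (𝒞.u (𝒞.s g))) g₀ :=
    ContMDiffAt.comp g₀ (g := c.κ) c.smooth_κ.self_of_nhds hus.contMDiffAt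
  have hc : ContMDiffAt I 𝓘(ℝ, Fin r → ℝ) ∞ (fun g => (mfderiv I 𝓘(ℝ, Fin r → ℝ) c.κ
      (𝒞.u (𝒞.s g)) (α (𝒞.s g)).1 : Fin r → ℝ)) g₀ :=
    ContMDiffAt.comp g₀ (contMDiffAt_mfderiv_section (hα (𝒞.s g₀)) c.smooth_κ)
      h𝒞.smooth_s.contMDiffAt
  have h0 : (𝒞.s g₀, c.κ (𝒞.u (𝒞.s g₀))) = (𝒞.t (𝒞.u (𝒞.s g₀)), 0) := by
    rw [c.κ_self, 𝒞.t_u]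
  have hproj : Filter.Tendsto (fun z : C × (Fin r → ℝ) => (𝒞.s z.1, z.2))
      (𝓝 (g₀, c.κ (𝒞.u (𝒞.s g₀)))) (𝓝 (𝒞.t (𝒞.u (𝒞.s g₀)), 0)) := by
    rw [← h0]
    exact ((h𝒞.smooth_s.continuous.comp continuous_fst).prodMk continuous_snd).continuousAt
  have hS : ∀ᶠ z in 𝓝 (g₀, c.κ (𝒞.u (𝒞.s g₀))), ContMDiffAt (I.prod 𝓘(ℝ, Fin r → ℝ)) I ∞
      (fun z : C × (Fin r → ℝ) => 𝒞.m z.1 (c.σ (𝒞.s z.1, z.2))) z := by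
    filter_upwards [hproj.eventually c.smooth_σ, (hproj.eventually c.t_σ).eventually_nhds]
      with z h1 h2
    refine h𝒞.contMDiffAt_m contMDiffAt_fst (ContMDiffAt.comp z h1
      ((h𝒞.smooth_s.contMDiffAt.comp z contMDiffAt_fst).prodMk contMDiffAt_snd)) ?_
    filter_upwards [h2] with y hy using hy.symm
  refine (contMDiffAt_partialDeriv_snd (a := id) hS contMDiffAt_id hb hc).congr_of_eventuallyEq ?_
  filter_upwards [hust.eventually (c.eventually_slice h𝒞.smooth_t), hust.eventually
    (c.eventually_mfderiv_comp_slice (J := I) (N := C) h𝒞.smooth_t)] with g ⟨h1, _, _⟩ h2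
  have h3 := h𝒞.hasMFDerivWithinAt_m_left g
  rw [𝒞.t_u] at h1 h2
  refine totalSpace_mk_eq ?_ ?_
  · simp only [id, h1, 𝒞.m_u]
  · exact (h2 _ _ h3 _ (α (𝒞.s g)).2).symm

end Smoothness

end ArrowCat

end

/-! ### Brackets of left-invariant extensions. -/

section

theorem tangentField_congr {E H M : Type*} [NormedAddCommGroup E] [NormedSpace ℝ E]
    [TopologicalSpace H] {I : ModelWithCorners ℝ E H} [TopologicalSpace M] [ChartedSpace H M]
    (Z : ∀ x : M, TangentSpace I x) {a b : M} (h : a = b) : @Eq E (Z a) (Z b) := by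
  rw [h]

theorem contMDiff_mlieBracket {E H M : Type*} [NormedAddCommGroup E] [NormedSpace ℝ E]
    [CompleteSpace E]
    [TopologicalSpace H] {I : ModelWithCorners ℝ E H} [TopologicalSpace M] [ChartedSpace H M]
    [h : IsManifold I ∞ M] {V W : ∀ x : M, TangentSpace I x}
    (hV : ContMDiff I I.tangent ∞ (fun x => (⟨x, V x⟩ : TangentBundle I M)))
    (hW : ContMDiff I I.tangent ∞ (fun x => (⟨x, W x⟩ : TangentBundle I M))) :
    ContMDiff I I.tangent ∞ (fun x => (⟨x, mlieBracket I V W x⟩ : TangentBundle I M)) := by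
  have : IsManifold I (((⊤ : ℕ∞) : ℕ∞ω) + 1) M := h
  have : IsManifold I (minSmoothness ℝ 2) M := by
    rw [minSmoothness_of_isRCLikeNormedField]; exact isManifold_two
  intro x
  exact ContMDiffAt.mlieBracket_vectorField (m := ⊤) (n := ⊤) (hV x) (hW x) (by simp)

theorem mdifferentiableAt_of_contMDiff_field {E H M : Type*} [NormedAddCommGroup E] [NormedSpace ℝ E]
    [TopologicalSpace H] {I : ModelWithCorners ℝ E H} [TopologicalSpace M] [ChartedSpace H M]
    [h : IsManifold I ∞ M] {V : ∀ x : M, TangentSpace I x}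
    (hV : ContMDiff I I.tangent ∞ (fun x => (⟨x, V x⟩ : TangentBundle I M))) (x : M) :
    MDifferentiableAt I I.tangent (fun x => (⟨x, V x⟩ : TangentBundle I M)) x :=
  (hV x).mdifferentiableAt (by simp)

namespace ArrowCat

section Bracket

variable {E H C F X : Type*} [NormedAddCommGroup E] [NormedSpace ℝ E] [FiniteDimensional ℝ E]
  [TopologicalSpace H]
  {I : ModelWithCorners ℝ E H} [TopologicalSpace C] [ChartedSpace H C] [IsManifold I ∞ C]
  [NormedAddCommGroup F] [NormedSpace ℝ F] [FiniteDimensional ℝ F]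
  [TopologicalSpace X] [ChartedSpace F X]
  [IsManifold 𝓘(ℝ, F) ∞ X] {𝒞 : ArrowCat C X} (h𝒞 : 𝒞.IsLieCategory F I)
  (hu : ∀ x, 𝒞.u x ∈ I.interior C)
  {α β : ∀ x, 𝒞.leftFibre F I x}
  (hα : (𝒞.leftAlgebroid F I).IsSmooth α) (hβ : (𝒞.leftAlgebroid F I).IsSmooth β)

include h𝒞 hu hα hβ

/-- Both extensions are `t`-related to the zero field, and so is their bracket. -/
theorem mfderiv_t_mlieBracket_leftExtension (g : C) :
    mfderiv I 𝓘(ℝ, F) 𝒞.t g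
      (mlieBracket I (𝒞.leftExtension F I α) (𝒞.leftExtension F I β) g) = 0 := by
  have : CompleteSpace E := FiniteDimensional.complete ℝ E
  have : CompleteSpace F := FiniteDimensional.complete ℝ F
  have : IsManifold I 1 C := isManifold_one
  have : IsManifold 𝓘(ℝ, F) 1 X := isManifold_one
  have h0 : MDifferentiableAt 𝓘(ℝ, F) 𝓘(ℝ, F).tangent
      (fun x => (⟨x, (0 : ∀ x, TangentSpace 𝓘(ℝ, F) x) x⟩ : TangentBundle 𝓘(ℝ, F) X)) (𝒞.t g) :=
    mdifferentiableAt_of_contMDiff_field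
      (Bundle.contMDiff_zeroSection ℝ (TangentSpace 𝓘(ℝ, F) : X → Type _)) _
  refine (mfderiv_mlieBracket_of_related h𝒞.smooth_t.contMDiffAt
    (mdifferentiableAt_of_contMDiff_field (contMDiff_leftExtension h𝒞 hu hα) g)
    (mdifferentiableAt_of_contMDiff_field (contMDiff_leftExtension h𝒞 hu hβ) g) h0 h0
    (.of_forall fun k => mfderiv_t_leftExtension h𝒞 hu α k)
    (.of_forall fun k => mfderiv_t_leftExtension h𝒞 hu β k)).trans ?_
  rw [mlieBracket_zero_left]; rfl

theorem leftBracketAtUnits_mem (x : X) :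
    𝒞.leftBracketAtUnits F I α β x ∈ 𝒞.leftFibre F I x :=
  mfderiv_t_mlieBracket_leftExtension h𝒞 hu hα hβ (𝒞.u x)

theorem bracket_apply (x : X) :
    ((𝒞.leftAlgebroid F I).bracket α β x : 𝒞.leftFibre F I x) =
      ⟨mlieBracket I (𝒞.leftExtension F I α) (𝒞.leftExtension F I β) (𝒞.u x),
        leftBracketAtUnits_mem h𝒞 hu hα hβ x⟩ :=
  dif_pos (leftBracketAtUnits_mem h𝒞 hu hα hβ x)

/-- The bracket of left-invariant fields is left-invariant. Since `L_g` is defined on a fibre only,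
the fibre is replaced by `ℝ^r`: a parametrization `ξ` near the unit and its translate `ρ = L_g ∘ ξ`
near `g` relate the same fields on `ℝ^r` to the two extensions. -/
theorem leftExtension_bracket (g : C) :
    𝒞.leftExtension F I ((𝒞.leftAlgebroid F I).bracket α β) g =
      mlieBracket I (𝒞.leftExtension F I α) (𝒞.leftExtension F I β) g := by
  have : CompleteSpace E := FiniteDimensional.complete ℝ E
  obtain ⟨r, ⟨c⟩⟩ : ∃ r, Nonempty (FibreChart F I 𝒞.t (𝒞.u (𝒞.s g)) r) :=
    ⟨_, exists_fibreChart h𝒞 hu (𝒞.s g)⟩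
  set V := 𝒞.leftExtension F I α with hV
  set W := 𝒞.leftExtension F I β with hW
  have hVs := contMDiff_leftExtension h𝒞 hu hα
  have hWs := contMDiff_leftExtension h𝒞 hu hβ
  obtain ⟨h1, h2, h3⟩ := (c.eventually_slice h𝒞.smooth_t).self_of_nhds
  rw [𝒞.t_u, c.κ_self] at h1 h2 h3
  set ξ : (Fin r → ℝ) → C := fun w => c.σ (𝒞.s g, w) with hξ
  set ρ : (Fin r → ℝ) → C := fun w => 𝒞.m g (ξ w) with hρ
  have hξ0 : ξ 0 = 𝒞.u (𝒞.s g) := h1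
  have hρ0 : ρ 0 = g := by simp only [hρ, hξ0, 𝒞.m_u]
  have hξc : Filter.Tendsto ξ (𝓝 0) (𝓝 (𝒞.u (𝒞.s g))) := by
    have := h3.self_of_nhds.continuousAt
    rwa [ContinuousAt, hξ0] at this
  have hρs : ContMDiffAt 𝓘(ℝ, Fin r → ℝ) I ∞ ρ 0 :=
    h𝒞.contMDiffAt_m contMDiffAt_const h3.self_of_nhds (by
      filter_upwards [h2] with w hw using hw.symm)
  have hκξ : ∀ᶠ w in 𝓝 (0 : Fin r → ℝ), c.κ (ξ w) = w := by
    have h4 := c.κ_σ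
    rw [𝒞.t_u] at h4
    exact ((Continuous.prodMk_right (𝒞.s g)).tendsto (0 : Fin r → ℝ)).eventually h4
  -- the coordinates of an extension along the fibre
  let A : (∀ k : C, TangentSpace I k) → ∀ w : Fin r → ℝ, TangentSpace 𝓘(ℝ, Fin r → ℝ) w :=
    fun Z w => (mfderiv I 𝓘(ℝ, Fin r → ℝ) c.κ (ξ w) (Z (ξ w)) : Fin r → ℝ)
  have hA : ∀ Z : ∀ k : C, TangentSpace I k,
      ContMDiff I I.tangent ∞ (fun k => (⟨k, Z k⟩ : TangentBundle I C)) →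
      MDifferentiableAt 𝓘(ℝ, Fin r → ℝ) 𝓘(ℝ, Fin r → ℝ).tangent
        (fun w => (⟨w, A Z w⟩ : TangentBundle 𝓘(ℝ, Fin r → ℝ) (Fin r → ℝ))) 0 := by
    intro Z hZ
    have h5 := ContMDiffAt.comp (0 : Fin r → ℝ) (contMDiffAt_tangentMap
      (p := ⟨ξ 0, Z (ξ 0)⟩) (by rw [hξ0]; exact c.smooth_κ))
      ((hZ (ξ 0)).comp 0 h3.self_of_nhds)
    have h6 := (contMDiff_snd_tangentBundle_modelSpace (Fin r → ℝ)
      𝓘(ℝ, Fin r → ℝ)).contMDiffAt.comp (0 : Fin r → ℝ) h5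
    exact (contMDiffAt_mk_model_space contMDiffAt_id h6).mdifferentiableAt (by simp)
  -- Extensions are tangent to the fibres, so their `κ`-coordinates determine them along `ξ`;
  -- left-invariance carries this over to `ρ`.
  have hrel : ∀ γ : ∀ x, 𝒞.leftFibre F I x, ∀ᶠ w in 𝓝 (0 : Fin r → ℝ),
      mfderiv 𝓘(ℝ, Fin r → ℝ) I ξ w (A (𝒞.leftExtension F I γ) w) =
        𝒞.leftExtension F I γ (ξ w) ∧
      mfderiv 𝓘(ℝ, Fin r → ℝ) I ρ w (A (𝒞.leftExtension F I γ) w) =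
        𝒞.leftExtension F I γ (ρ w) := by
    intro γ
    filter_upwards [h2, hκξ, hξc.eventually (c.eventually_mfderiv_σ h𝒞.smooth_t),
      hξc.eventually (c.eventually_mfderiv_comp_slice (J := I) (N := C) h𝒞.smooth_t)]
      with w hw1 hw2 hw3 hw4
    have hw1' : 𝒞.t (ξ w) = 𝒞.s g := hw1
    have hD := ((h𝒞.contMDiffWithinAt_m_left hw1'.symm).mdifferentiableWithinAt
      (by simp)).hasMFDerivWithinAt
    rw [hw1', hw2] at hw3 hw4
    have h7 := mfderiv_t_leftExtension h𝒞 hu γ (ξ w)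
    exact ⟨hw3 _ h7, (hw4 _ _ hD _ h7).trans (map_leftExtension h𝒞 hu γ hw1'.symm hD)⟩
  have hb1 := mfderiv_mlieBracket_of_related h3.self_of_nhds (hA V hVs) (hA W hWs)
    (mdifferentiableAt_of_contMDiff_field hVs _) (mdifferentiableAt_of_contMDiff_field hWs _)
    ((hrel α).mono fun _ h => h.1) ((hrel β).mono fun _ h => h.1)
  have hb2 := mfderiv_mlieBracket_of_related hρs (hA V hVs) (hA W hWs)
    (mdifferentiableAt_of_contMDiff_field hVs _) (mdifferentiableAt_of_contMDiff_field hWs _)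
    ((hrel α).mono fun _ h => h.2) ((hrel β).mono fun _ h => h.2)
  have hL := h𝒞.hasMFDerivWithinAt_m_left g
  have hch := ((hL.comp_of_eq' (h3.self_of_nhds.mdifferentiableAt
    (by simp)).hasMFDerivAt.hasMFDerivWithinAt (s := {w | 𝒞.t (ξ w) = 𝒞.s g}) hξ0
    (fun w hw => hw)).hasMFDerivAt h2).mfderiv
  have hval : @Eq E ((𝒞.leftAlgebroid F I).bracket α β (𝒞.s g) : 𝒞.leftFibre F I (𝒞.s g)).1
      (mlieBracket I V W (𝒞.u (𝒞.s g))) :=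
    congrArg Subtype.val (bracket_apply h𝒞 hu hα hβ (𝒞.s g))
  have e1 := tangentField_congr (mlieBracket I V W) hξ0
  have e2 := tangentField_congr (mlieBracket I V W) hρ0
  have e3 := hb1.trans e1
  -- As `dρ` at `0` is the derivative of `L_g` after `dξ`, the bracket at `g` is the image under
  -- `L_g` of the bracket at the unit.
  have e4 := (DFunLike.congr_fun hch (mlieBracket 𝓘(ℝ, Fin r → ℝ) (A V) (A W) 0)).symm.trans
    (hb2.trans e2)
  refine Eq.trans ?_ e4
  exact congrArg (mfderivWithin I I (𝒞.m g) (𝒞.tFibre (𝒞.s g)) (𝒞.u (𝒞.s g)))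
    (hval.trans e3.symm)

end Bracket

end ArrowCat

end

/-! ### The Lie algebroid laws. -/

section

theorem finrank_ker_of_surjective {E F : Type*} [NormedAddCommGroup E] [NormedSpace ℝ E]
    [NormedAddCommGroup F] [NormedSpace ℝ F] [FiniteDimensional ℝ E] {A : E →L[ℝ] F}
    (hA : Function.Surjective A) : Module.finrank ℝ (LinearMap.ker A.toLinearMap) =
      Module.finrank ℝ E - Module.finrank ℝ F := by
  have h1 := LinearMap.finrank_range_add_finrank_ker A.toLinearMap
  rw [LinearMap.range_eq_top.2 hA, finrank_top] at h1
  omega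

theorem bijective_of_injective_of_finrank_eq {E : Type*} [NormedAddCommGroup E] [NormedSpace ℝ E]
    [FiniteDimensional ℝ E] {S : Submodule ℝ E} {r : ℕ} (hS : Module.finrank ℝ S = r)
    {e : S →ₗ[ℝ] (Fin r → ℝ)} (he : Function.Injective e) : Function.Bijective e :=
  ⟨he, (LinearMap.injective_iff_surjective_of_finrank_eq_finrank (by rw [hS]; simp)).1 he⟩

namespace ArrowCat

section LieAlgebroid

variable {E H C F X : Type*} [NormedAddCommGroup E] [NormedSpace ℝ E] [FiniteDimensional ℝ E]
  [TopologicalSpace H]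
  {I : ModelWithCorners ℝ E H} [TopologicalSpace C] [ChartedSpace H C] [IsManifold I ∞ C]
  [NormedAddCommGroup F] [NormedSpace ℝ F] [FiniteDimensional ℝ F]
  [TopologicalSpace X] [ChartedSpace F X]
  [IsManifold 𝓘(ℝ, F) ∞ X] {𝒞 : ArrowCat C X}

theorem leftExtension_add (α β : ∀ x, 𝒞.leftFibre F I x) :
    𝒞.leftExtension F I (fun x => α x + β x) =
      𝒞.leftExtension F I α + 𝒞.leftExtension F I β := by
  funext g
  exact map_add (mfderivWithin I I (𝒞.m g) (𝒞.tFibre (𝒞.s g)) (𝒞.u (𝒞.s g))) _ _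

theorem leftExtension_smul (f : X → ℝ) (α : ∀ x, 𝒞.leftFibre F I x) :
    𝒞.leftExtension F I (fun x => f x • α x) = (fun g => f (𝒞.s g)) • 𝒞.leftExtension F I α := by
  funext g
  exact map_smul (mfderivWithin I I (𝒞.m g) (𝒞.tFibre (𝒞.s g)) (𝒞.u (𝒞.s g))) _ _

variable (h𝒞 : 𝒞.IsLieCategory F I) (hu : ∀ x, 𝒞.u x ∈ I.interior C)

include h𝒞 hu

/-- The trivialization is `dκ` restricted to `ker dt`. It is injective because the derivative of `σ`
along the fibre inverts it, and bijective by dimension; the same inverse recovers a smooth section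
from smooth coordinates. -/
theorem leftAlgebroid_locally_trivial (x₀ : X) :
    ∃ U ∈ 𝓝 x₀, ∃ e : ∀ x, (𝒞.leftAlgebroid F I).fibre x →ₗ[ℝ]
        (Fin (Module.finrank ℝ E - Module.finrank ℝ F) → ℝ),
      (∀ x ∈ U, Function.Bijective (e x)) ∧
      ∀ (α : ∀ x, (𝒞.leftAlgebroid F I).fibre x), ∀ y ∈ U,
        (𝒞.leftAlgebroid F I).IsSmoothAt α y ↔
          ContMDiffAt 𝓘(ℝ, F) 𝓘(ℝ, Fin (Module.finrank ℝ E - Module.finrank ℝ F) → ℝ) ∞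
            (fun x => e x (α x)) y := by
  have hk : ∀ x, Module.finrank ℝ (LinearMap.ker (show E →L[ℝ] F from
      mfderiv I 𝓘(ℝ, F) 𝒞.t (𝒞.u x)).toLinearMap) = Module.finrank ℝ E - Module.finrank ℝ F :=
    fun x => finrank_ker_of_surjective (h𝒞.submersion_t (𝒞.u x))
  obtain ⟨c⟩ := exists_fibreChart h𝒞 hu x₀
  -- The value of the rank matters only for the dimension count, which `hk` retains.
  generalize Module.finrank ℝ E - Module.finrank ℝ F = r at c hk ⊢
  have hκc : Filter.Tendsto (fun g => (𝒞.t g, c.κ g)) (𝓝 (𝒞.u x₀)) (𝓝 (𝒞.t (𝒞.u x₀), 0)) := by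
    have := (h𝒞.smooth_t.continuous.continuousAt (x := 𝒞.u x₀)).prodMk
      c.smooth_κ.self_of_nhds.continuousAt
    rwa [ContinuousAt, c.κ_self] at this
  have huc : Filter.Tendsto 𝒞.u (𝓝 x₀) (𝓝 (𝒞.u x₀)) := h𝒞.smooth_u.continuous.continuousAt
  have key := huc.eventually (c.smooth_κ.eventually_nhds.and
    ((hκc.eventually c.smooth_σ.eventually_nhds).and
    ((c.eventually_slice h𝒞.smooth_t).and (c.eventually_mfderiv_σ h𝒞.smooth_t))))
  let e : ∀ x, (𝒞.leftAlgebroid F I).fibre x →ₗ[ℝ] (Fin r → ℝ) := fun x =>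
    ((mfderiv I 𝓘(ℝ, Fin r → ℝ) c.κ (𝒞.u x)).toLinearMap.comp (𝒞.leftFibre F I x).subtype :
      𝒞.leftFibre F I x →ₗ[ℝ] (Fin r → ℝ))
  have hinv : ∀ᶠ x in 𝓝 x₀, ∀ v : 𝒞.leftFibre F I x,
      @Eq E (mfderiv 𝓘(ℝ, Fin r → ℝ) I (fun w => c.σ (x, w)) (c.κ (𝒞.u x)) (e x v)) v.1 := by
    filter_upwards [key] with x ⟨_, _, _, h⟩ v
    rw [𝒞.t_u] at h
    exact h v.1 v.2
  -- Smoothness at each point of the neighbourhood has to be characterized, so the conditions are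
  -- imposed near every such point.
  refine ⟨{x | (∀ᶠ g in 𝓝 (𝒞.u x), ContMDiffAt I 𝓘(ℝ, Fin r → ℝ) ∞ c.κ g) ∧
    (∀ᶠ z in 𝓝 (x, c.κ (𝒞.u x)),
      ContMDiffAt (𝓘(ℝ, F).prod 𝓘(ℝ, Fin r → ℝ)) I ∞ c.σ z) ∧
    ∀ᶠ y in 𝓝 x, c.σ (y, c.κ (𝒞.u y)) = 𝒞.u y ∧ ∀ v : 𝒞.leftFibre F I y,
      @Eq E (mfderiv 𝓘(ℝ, Fin r → ℝ) I (fun w => c.σ (y, w)) (c.κ (𝒞.u y)) (e y v)) v.1},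
    ?_, e, ?_, ?_⟩
  · filter_upwards [key.eventually_nhds, hinv.eventually_nhds] with x h1 h2
    refine ⟨h1.self_of_nhds.1, ?_, ?_⟩
    · have := h1.self_of_nhds.2.1
      rwa [𝒞.t_u] at this
    · filter_upwards [h1, h2] with y hy1 hy2
      refine ⟨?_, hy2⟩
      have := hy1.2.2.1.1
      rwa [𝒞.t_u] at this
  · rintro x ⟨-, -, h⟩
    have hi : Function.Injective (e x) := by
      intro v w hvw
      refine Subtype.ext ?_
      exact (h.self_of_nhds.2 v).symm.trans ((congrArg _ hvw).trans (h.self_of_nhds.2 w))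
    exact bijective_of_injective_of_finrank_eq (hk x) (e := e x) hi
  · rintro α y ⟨h1, h2, h3⟩
    refine ⟨fun hα => contMDiffAt_mfderiv_section hα h1, fun hα => ?_⟩
    have hb : ContMDiffAt 𝓘(ℝ, F) 𝓘(ℝ, Fin r → ℝ) ∞ (fun y => c.κ (𝒞.u y)) y :=
      ContMDiffAt.comp y h1.self_of_nhds h𝒞.smooth_u.contMDiffAt
    have h4 := contMDiffAt_partialDeriv_snd (a := id) (y₀ := y) h2 contMDiffAt_id hb hα
    refine ContMDiffAt.congr_of_eventuallyEq h4 ?_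
    filter_upwards [h3] with z hz
    exact totalSpace_mk_eq hz.1.symm (hz.2 (α z)).symm

theorem leftAlgebroid_anchor_smooth (α : ∀ x, (𝒞.leftAlgebroid F I).fibre x) (x : X)
    (hα : (𝒞.leftAlgebroid F I).IsSmoothAt α x) :
    ContMDiffAt 𝓘(ℝ, F) 𝓘(ℝ, F).tangent ∞
      (fun y => (⟨y, (𝒞.leftAlgebroid F I).anchor y (α y)⟩ : TangentBundle 𝓘(ℝ, F) X)) x := by
  have h1 := (contMDiffAt_tangentMap (p := ⟨𝒞.u x, (show 𝒞.leftFibre F I x from α x).1⟩)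
    (.of_forall h𝒞.smooth_s)).comp x hα
  refine ContMDiffAt.congr_of_eventuallyEq h1 (.of_forall fun y => ?_)
  exact totalSpace_mk_eq (𝒞.s_u y).symm rfl

theorem leftAlgebroid_bracket_smooth {α β : ∀ x, 𝒞.leftFibre F I x}
    (hα : (𝒞.leftAlgebroid F I).IsSmooth α) (hβ : (𝒞.leftAlgebroid F I).IsSmooth β) :
    (𝒞.leftAlgebroid F I).IsSmooth ((𝒞.leftAlgebroid F I).bracket α β) := by
  have : CompleteSpace E := FiniteDimensional.complete ℝ E
  intro x
  have h1 := ((contMDiff_mlieBracket (contMDiff_leftExtension h𝒞 hu hα)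
    (contMDiff_leftExtension h𝒞 hu hβ)).comp h𝒞.smooth_u).contMDiffAt (x := x)
  refine ContMDiffAt.congr_of_eventuallyEq h1 (.of_forall fun y => ?_)
  exact totalSpace_mk_eq rfl (congrArg Subtype.val (bracket_apply h𝒞 hu hα hβ y))

theorem leftAlgebroid_isSmoothAt_add {α β : ∀ x, 𝒞.leftFibre F I x} {x : X}
    (hα : (𝒞.leftAlgebroid F I).IsSmoothAt α x) (hβ : (𝒞.leftAlgebroid F I).IsSmoothAt β x) :
    (𝒞.leftAlgebroid F I).IsSmoothAt (fun y => α y + β y) x := by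
  obtain ⟨U, hU, e, -, he⟩ := leftAlgebroid_locally_trivial h𝒞 hu x
  have hx := mem_of_mem_nhds hU
  refine (he _ x hx).2 ((((he α x hx).1 hα).add ((he β x hx).1 hβ)).congr_of_eventuallyEq
    (.of_forall fun y => ?_))
  exact map_add (e y) (α y) (β y)

theorem leftAlgebroid_isSmoothAt_smul {α : ∀ x, 𝒞.leftFibre F I x} {x : X} {f : X → ℝ}
    (hf : ContMDiffAt 𝓘(ℝ, F) 𝓘(ℝ, ℝ) ∞ f x) (hα : (𝒞.leftAlgebroid F I).IsSmoothAt α x) :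
    (𝒞.leftAlgebroid F I).IsSmoothAt (fun y => f y • α y) x := by
  obtain ⟨U, hU, e, -, he⟩ := leftAlgebroid_locally_trivial h𝒞 hu x
  have hx := mem_of_mem_nhds hU
  refine (he _ x hx).2 ((hf.smul ((he α x hx).1 hα)).congr_of_eventuallyEq
    (.of_forall fun y => ?_))
  exact map_smul (e y) (f y) (α y)

/-- The extension of `f • β` is `(f ∘ s) • β^L`, and the derivative of `f ∘ s` along `α^L` at a unit
is that of `f` along the anchor of `α`. -/
theorem mlieBracket_leftExtension_smul {α β : ∀ x, 𝒞.leftFibre F I x}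
    (hβ : (𝒞.leftAlgebroid F I).IsSmooth β) {f : X → ℝ} (hf : ContMDiff 𝓘(ℝ, F) 𝓘(ℝ, ℝ) ∞ f)
    (x : X) :
    @Eq E (mlieBracket I (𝒞.leftExtension F I α)
        (𝒞.leftExtension F I (fun y => f y • β y)) (𝒞.u x))
      (f x • (mlieBracket I (𝒞.leftExtension F I α) (𝒞.leftExtension F I β) (𝒞.u x) : E) +
        LieAlgebroidData.dirDeriv f x ((𝒞.leftAlgebroid F I).anchor x (α x)) • ((β x).1 : E)) := by
  have : CompleteSpace E := FiniteDimensional.complete ℝ E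
  have : IsManifold I 2 C := isManifold_two
  have hfs : MDifferentiableAt I 𝓘(ℝ, ℝ) (fun g => f (𝒞.s g)) (𝒞.u x) :=
    (hf.comp h𝒞.smooth_s).contMDiffAt.mdifferentiableAt (by simp)
  have h1 := mlieBracket_smul_right (V := 𝒞.leftExtension F I α) hfs
    (mdifferentiableAt_of_contMDiff_field (contMDiff_leftExtension h𝒞 hu hβ) (𝒞.u x))
  have h2 : mfderiv I 𝓘(ℝ, ℝ) (fun g => f (𝒞.s g)) (𝒞.u x) =
      (mfderiv 𝓘(ℝ, F) 𝓘(ℝ, ℝ) f x : F →L[ℝ] ℝ).comp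
        (mfderiv I 𝓘(ℝ, F) 𝒞.s (𝒞.u x) : E →L[ℝ] F) :=
    (((hf.contMDiffAt.mdifferentiableAt (by simp)).hasMFDerivAt.hasMFDerivWithinAt
      (s := univ)).comp_of_eq' (h𝒞.smooth_s.contMDiffAt.mdifferentiableAt
        (by simp)).hasMFDerivAt.hasMFDerivWithinAt (𝒞.s_u x)
      (subset_univ _)).hasMFDerivAt Filter.univ_mem |>.mfderiv
  have h3 : @Eq ℝ (mfderiv I 𝓘(ℝ, ℝ) (fun g => f (𝒞.s g)) (𝒞.u x)
      (𝒞.leftExtension F I α (𝒞.u x)))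
      (LieAlgebroidData.dirDeriv f x ((𝒞.leftAlgebroid F I).anchor x (α x))) := by
    refine (DFunLike.congr_fun h2 _).trans (Eq.trans ?_ (congrArg (fun v : E =>
      (show F →L[ℝ] ℝ from mfderiv 𝓘(ℝ, F) 𝓘(ℝ, ℝ) f x)
        ((show E →L[ℝ] F from mfderiv I 𝓘(ℝ, F) 𝒞.s (𝒞.u x)) v))
      (leftExtension_u h𝒞 hu α x)))
    rfl
  rw [leftExtension_smul]
  refine h1.trans ?_
  rw [add_comm]
  refine congrArg₂ (fun v w : E => v + w) ?_ ?_
  · exact congrArg (fun c : ℝ => c • (mlieBracket I (𝒞.leftExtension F I α)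
      (𝒞.leftExtension F I β) (𝒞.u x) : E)) (congrArg f (𝒞.s_u x))
  · exact congrArg₂ (fun (c : ℝ) (v : E) => c • v) h3 (leftExtension_u h𝒞 hu β x)

/-- Extensions are `s`-related to the anchored fields on `X`; compare brackets at `u x`. -/
theorem anchor_bracket {α β : ∀ x, 𝒞.leftFibre F I x}
    (hα : (𝒞.leftAlgebroid F I).IsSmooth α) (hβ : (𝒞.leftAlgebroid F I).IsSmooth β) (x : X) :
    (𝒞.leftAlgebroid F I).anchor x ((𝒞.leftAlgebroid F I).bracket α β x) =
      mlieBracket 𝓘(ℝ, F) (fun y => (𝒞.leftAlgebroid F I).anchor y (α y))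
        (fun y => (𝒞.leftAlgebroid F I).anchor y (β y)) x := by
  have : CompleteSpace E := FiniteDimensional.complete ℝ E
  have : CompleteSpace F := FiniteDimensional.complete ℝ F
  have : IsManifold I 1 C := isManifold_one
  have : IsManifold 𝓘(ℝ, F) 1 X := isManifold_one
  have h1 := mfderiv_mlieBracket_of_related (h𝒞.smooth_s.contMDiffAt (x := 𝒞.u x))
    (mdifferentiableAt_of_contMDiff_field (contMDiff_leftExtension h𝒞 hu hα) _)
    (mdifferentiableAt_of_contMDiff_field (contMDiff_leftExtension h𝒞 hu hβ) _)
    ((leftAlgebroid_anchor_smooth h𝒞 hu α _ (hα _)).mdifferentiableAt (by simp))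
    ((leftAlgebroid_anchor_smooth h𝒞 hu β _ (hβ _)).mdifferentiableAt (by simp))
    (.of_forall fun k => mfderiv_s_leftExtension h𝒞 hu α k)
    (.of_forall fun k => mfderiv_s_leftExtension h𝒞 hu β k)
  have h2 := tangentField_congr (mlieBracket 𝓘(ℝ, F) (fun y => (𝒞.leftAlgebroid F I).anchor y (α y))
    (fun y => (𝒞.leftAlgebroid F I).anchor y (β y))) (𝒞.s_u x)
  refine Eq.trans ?_ (h1.trans h2)
  exact congrArg (fun v : 𝒞.leftFibre F I x => (mfderiv I 𝓘(ℝ, F) 𝒞.s (𝒞.u x) : E →L[ℝ] F) v.1)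
    (bracket_apply h𝒞 hu hα hβ x)

theorem jacobi {α β γ : ∀ x, 𝒞.leftFibre F I x}
    (hα : (𝒞.leftAlgebroid F I).IsSmooth α) (hβ : (𝒞.leftAlgebroid F I).IsSmooth β)
    (hγ : (𝒞.leftAlgebroid F I).IsSmooth γ) (x : X) :
    ((𝒞.leftAlgebroid F I).bracket α ((𝒞.leftAlgebroid F I).bracket β γ) x :
        𝒞.leftFibre F I x) =
      ((𝒞.leftAlgebroid F I).bracket ((𝒞.leftAlgebroid F I).bracket α β) γ x :
        𝒞.leftFibre F I x) +
      ((𝒞.leftAlgebroid F I).bracket β ((𝒞.leftAlgebroid F I).bracket α γ) x :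
        𝒞.leftFibre F I x) := by
  have : CompleteSpace E := FiniteDimensional.complete ℝ E
  have : IsManifold I (minSmoothness ℝ 3) C := by
    rw [minSmoothness_of_isRCLikeNormedField]
    exact IsManifold.of_le (show ((3 : ℕ∞) : ℕ∞ω) ≤ ∞ from mod_cast le_top)
  have h2 : minSmoothness ℝ 2 ≤ (∞ : ℕ∞ω) := by
    rw [minSmoothness_of_isRCLikeNormedField]
    exact show ((2 : ℕ∞) : ℕ∞ω) ≤ ∞ from mod_cast le_top
  have hαβ := leftAlgebroid_bracket_smooth h𝒞 hu hα hβ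
  have hβγ := leftAlgebroid_bracket_smooth h𝒞 hu hβ hγ
  have hαγ := leftAlgebroid_bracket_smooth h𝒞 hu hα hγ
  have h1 := leibniz_identity_mlieBracket_apply
    ((contMDiff_leftExtension h𝒞 hu hα (𝒞.u x)).of_le h2)
    ((contMDiff_leftExtension h𝒞 hu hβ (𝒞.u x)).of_le h2)
    ((contMDiff_leftExtension h𝒞 hu hγ (𝒞.u x)).of_le h2)
  -- A nested bracket extends an inner bracket, which is the bracket of the extensions as a field on
  -- all of `C`. Agreement at the units alone would not suffice to differentiate it.
  have eαβ := funext (leftExtension_bracket h𝒞 hu hα hβ)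
  have eβγ := funext (leftExtension_bracket h𝒞 hu hβ hγ)
  have eαγ := funext (leftExtension_bracket h𝒞 hu hα hγ)
  refine (bracket_apply h𝒞 hu hα hβγ x).trans (Eq.trans ?_ (congrArg₂ (fun v w => v + w)
    (bracket_apply h𝒞 hu hαβ hγ x) (bracket_apply h𝒞 hu hβ hαγ x)).symm)
  refine Subtype.ext ?_
  exact (congrArg (fun Z => mlieBracket I (𝒞.leftExtension F I α) Z (𝒞.u x)) eβγ).trans
    (h1.trans (congrArg₂ (fun v w => v + w)
      (congrArg (fun Z => mlieBracket I Z (𝒞.leftExtension F I γ) (𝒞.u x)) eαβ)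
      (congrArg (fun Z => mlieBracket I (𝒞.leftExtension F I β) Z (𝒞.u x)) eαγ)).symm)

theorem leftAlgebroid_isLieAlgebroid : (𝒞.leftAlgebroid F I).IsLieAlgebroid := by
  have : CompleteSpace E := FiniteDimensional.complete ℝ E
  have : IsManifold I 2 C := isManifold_two
  refine ⟨⟨_, leftAlgebroid_locally_trivial h𝒞 hu⟩, leftAlgebroid_anchor_smooth h𝒞 hu,
    fun α β hα hβ => leftAlgebroid_bracket_smooth h𝒞 hu hα hβ, ?_, ?_,
    fun α β γ hα hβ hγ => funext (jacobi h𝒞 hu hα hβ hγ),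
    fun α β hα hβ => anchor_bracket h𝒞 hu hα hβ, ?_⟩
  · intro α β γ hα hβ hγ
    have hβγ : (𝒞.leftAlgebroid F I).IsSmooth (β + γ) :=
      fun x => leftAlgebroid_isSmoothAt_add h𝒞 hu (hβ x) (hγ x)
    funext x
    refine (bracket_apply h𝒞 hu hα hβγ x).trans (Eq.trans ?_ (congrArg₂
      (fun v w : 𝒞.leftFibre F I x => v + w)
      (bracket_apply h𝒞 hu hα hβ x) (bracket_apply h𝒞 hu hα hγ x)).symm)
    refine Subtype.ext ?_
    exact (congrArg (fun Z => mlieBracket I (𝒞.leftExtension F I α) Z (𝒞.u x))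
      (leftExtension_add β γ)).trans (mlieBracket_add_right
        (mdifferentiableAt_of_contMDiff_field (contMDiff_leftExtension h𝒞 hu hβ) _)
        (mdifferentiableAt_of_contMDiff_field (contMDiff_leftExtension h𝒞 hu hγ) _))
  · intro α β hα hβ
    funext x
    refine (bracket_apply h𝒞 hu hα hβ x).trans ?_
    refine Eq.trans ?_ (congrArg (fun v : 𝒞.leftFibre F I x => -v)
      (bracket_apply h𝒞 hu hβ hα x).symm)
    exact Subtype.ext mlieBracket_swap_apply
  · intro α β hα hβ f hf x
    have hfβ : (𝒞.leftAlgebroid F I).IsSmooth (fun y => f y • β y) :=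
      fun x => leftAlgebroid_isSmoothAt_smul h𝒞 hu hf.contMDiffAt (hβ x)
    refine (bracket_apply h𝒞 hu hα hfβ x).trans (Eq.trans ?_ (congrArg
      (fun v : 𝒞.leftFibre F I x => f x • v + (LieAlgebroidData.dirDeriv f x
        ((𝒞.leftAlgebroid F I).anchor x (α x)) • (show 𝒞.leftFibre F I x from β x) :
          𝒞.leftFibre F I x))
      (bracket_apply h𝒞 hu hα hβ x)).symm)
    exact Subtype.ext (mlieBracket_leftExtension_smul h𝒞 hu hβ hf x)

theorem hasLeftAlgebroid : 𝒞.HasLeftAlgebroid F I :=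
  ⟨fun _ _ hα hβ => leftBracketAtUnits_mem h𝒞 hu hα hβ, leftAlgebroid_isLieAlgebroid h𝒞 hu⟩

end LieAlgebroid

end ArrowCat

end

/-! ### Isomorphisms of algebroids induced by functors. -/

section

/-- Two inverse linear maps restrict to an isomorphism of corresponding subspaces. -/
def Submodule.equivOfInverse {E : Type*} [NormedAddCommGroup E] [NormedSpace ℝ E]
    {S T : Submodule ℝ E} {A B : E →L[ℝ] E} (hA : ∀ v, A v ∈ T ↔ v ∈ S)
    (hBA : ∀ v, B (A v) = v) (hAB : ∀ v, A (B v) = v) : S ≃ₗ[ℝ] T where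
  toFun v := ⟨A v, (hA v).2 v.2⟩
  invFun v := ⟨B v, (hA _).1 (by rw [hAB]; exact v.2)⟩
  map_add' v w := Subtype.ext (map_add A v.1 w.1)
  map_smul' c v := Subtype.ext (map_smul A c v.1)
  left_inv v := Subtype.ext (hBA v)
  right_inv v := Subtype.ext (hAB v)

theorem mfderiv_comp_of_point_eq {E H M E' H' M' E'' H'' M'' : Type*}
    [NormedAddCommGroup E] [NormedSpace ℝ E] [TopologicalSpace H] {I : ModelWithCorners ℝ E H}
    [TopologicalSpace M] [ChartedSpace H M]
    [NormedAddCommGroup E'] [NormedSpace ℝ E'] [TopologicalSpace H'] {I' : ModelWithCorners ℝ E' H'}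
    [TopologicalSpace M'] [ChartedSpace H' M']
    [NormedAddCommGroup E''] [NormedSpace ℝ E''] [TopologicalSpace H'']
    {I'' : ModelWithCorners ℝ E'' H''} [TopologicalSpace M''] [ChartedSpace H'' M'']
    {g : M' → M''} {f : M → M'} {x : M} {y : M'} (hg : MDifferentiableAt I' I'' g y)
    (hf : MDifferentiableAt I I' f x) (hy : f x = y) :
    mfderiv I I'' (fun z => g (f z)) x =
      (mfderiv I' I'' g y : E' →L[ℝ] E'').comp (mfderiv I I' f x : E →L[ℝ] E') := by
  subst hy
  exact mfderiv_comp x hg hf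

namespace ArrowCat

section Functor

variable {E H C D F X : Type*} [NormedAddCommGroup E] [NormedSpace ℝ E] [FiniteDimensional ℝ E]
  [TopologicalSpace H]
  {I : ModelWithCorners ℝ E H} [TopologicalSpace C] [ChartedSpace H C] [IsManifold I ∞ C]
  [TopologicalSpace D] [ChartedSpace H D] [IsManifold I ∞ D]
  [NormedAddCommGroup F] [NormedSpace ℝ F] [FiniteDimensional ℝ F]
  [TopologicalSpace X] [ChartedSpace F X]
  [IsManifold 𝓘(ℝ, F) ∞ X] {𝒞 : ArrowCat C X} {𝒟 : ArrowCat D X}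

/-- A functor over the identity of the objects that is a diffeomorphism near the units: `ψ` is
inverse to `φ` there. -/
structure IsLocalIso (I : ModelWithCorners ℝ E H) (𝒞 : ArrowCat C X) (𝒟 : ArrowCat D X)
    (φ : C → D) (ψ : D → C) : Prop where
  smooth : ContMDiff I I ∞ φ
  s_map : ∀ g, 𝒟.s (φ g) = 𝒞.s g
  t_map : ∀ g, 𝒟.t (φ g) = 𝒞.t g
  u_map : ∀ x, φ (𝒞.u x) = 𝒟.u x
  m_map : ∀ g h, 𝒞.s g = 𝒞.t h → φ (𝒞.m g h) = 𝒟.m (φ g) (φ h)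
  smooth_inverse : ∀ x, ∀ᶠ d in 𝓝 (𝒟.u x), ContMDiffAt I I ∞ ψ d
  inverse_map : ∀ x, ∀ᶠ g in 𝓝 (𝒞.u x), ψ (φ g) = g
  map_inverse : ∀ x, ∀ᶠ d in 𝓝 (𝒟.u x), φ (ψ d) = d

namespace IsLocalIso

variable {φ : C → D} {ψ : D → C} (h : IsLocalIso I 𝒞 𝒟 φ ψ)

include h

theorem inverse_u (x : X) : ψ (𝒟.u x) = 𝒞.u x := by
  rw [← h.u_map]
  exact (h.inverse_map x).self_of_nhds

theorem mfderiv_inverse_mfderiv (x : X) (v : E) :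
    @Eq E (mfderiv I I ψ (𝒟.u x) (mfderiv I I φ (𝒞.u x) v)) v := by
  have h1 := mfderiv_comp_of_point_eq ((h.smooth_inverse x).self_of_nhds.mdifferentiableAt (by simp))
    (h.smooth.contMDiffAt.mdifferentiableAt (by simp)) (h.u_map x)
  have h2 : (fun g => ψ (φ g)) =ᶠ[𝓝 (𝒞.u x)] id := h.inverse_map x
  rw [h2.mfderiv_eq, mfderiv_id] at h1
  exact (DFunLike.congr_fun h1 v).symm

theorem mfderiv_mfderiv_inverse (x : X) (v : E) :
    @Eq E (mfderiv I I φ (𝒞.u x) (mfderiv I I ψ (𝒟.u x) v)) v := by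
  have h1 := mfderiv_comp_of_point_eq (h.smooth.contMDiffAt.mdifferentiableAt (by simp))
    ((h.smooth_inverse x).self_of_nhds.mdifferentiableAt (by simp)) (h.inverse_u x)
  have h2 : (fun g => φ (ψ g)) =ᶠ[𝓝 (𝒟.u x)] id := h.map_inverse x
  rw [h2.mfderiv_eq, mfderiv_id] at h1
  exact (DFunLike.congr_fun h1 v).symm

theorem mfderiv_t_mfderiv (h𝒟 : 𝒟.IsLieCategory F I) (x : X) (v : E) :
    @Eq F (mfderiv I 𝓘(ℝ, F) 𝒟.t (𝒟.u x) (mfderiv I I φ (𝒞.u x) v))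
      (mfderiv I 𝓘(ℝ, F) 𝒞.t (𝒞.u x) v) := by
  have h1 := mfderiv_comp_of_point_eq (h𝒟.smooth_t.contMDiffAt.mdifferentiableAt (by simp))
    (h.smooth.contMDiffAt.mdifferentiableAt (by simp)) (h.u_map x)
  have h2 : (fun g => 𝒟.t (φ g)) = 𝒞.t := funext h.t_map
  rw [h2] at h1
  exact (DFunLike.congr_fun h1 v).symm

theorem mfderiv_s_mfderiv (h𝒟 : 𝒟.IsLieCategory F I) (x : X) (v : E) :
    @Eq F (mfderiv I 𝓘(ℝ, F) 𝒟.s (𝒟.u x) (mfderiv I I φ (𝒞.u x) v))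
      (mfderiv I 𝓘(ℝ, F) 𝒞.s (𝒞.u x) v) := by
  have h1 := mfderiv_comp_of_point_eq (h𝒟.smooth_s.contMDiffAt.mdifferentiableAt (by simp))
    (h.smooth.contMDiffAt.mdifferentiableAt (by simp)) (h.u_map x)
  have h2 : (fun g => 𝒟.s (φ g)) = 𝒞.s := funext h.s_map
  rw [h2] at h1
  exact (DFunLike.congr_fun h1 v).symm

/-- The differential at the units, on the fibres of the left Lie algebroids. -/
def fibreEquiv (h𝒟 : 𝒟.IsLieCategory F I) (x : X) : 𝒞.leftFibre F I x ≃ₗ[ℝ] 𝒟.leftFibre F I x :=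
  Submodule.equivOfInverse (E := E) (A := mfderiv I I φ (𝒞.u x)) (B := mfderiv I I ψ (𝒟.u x))
    (S := 𝒞.leftFibre F I x) (T := 𝒟.leftFibre F I x)
    (fun v => by
      have := h.mfderiv_t_mfderiv h𝒟 x v
      exact ⟨fun hv => this.symm.trans hv, fun hv => this.trans hv⟩)
    (h.mfderiv_inverse_mfderiv x) (h.mfderiv_mfderiv_inverse x)

theorem isSmoothAt_iff (h𝒟 : 𝒟.IsLieCategory F I) (α : ∀ x, 𝒞.leftFibre F I x) (x : X) :
    (𝒞.leftAlgebroid F I).IsSmoothAt α x ↔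
      (𝒟.leftAlgebroid F I).IsSmoothAt (fun y => h.fibreEquiv h𝒟 y (α y)) x := by
  constructor
  · intro hα
    refine ContMDiffAt.congr_of_eventuallyEq ((contMDiffAt_tangentMap (p := ⟨𝒞.u x, (α x).1⟩)
      (.of_forall h.smooth)).comp x hα) (.of_forall fun y => ?_)
    exact totalSpace_mk_eq (h.u_map y).symm rfl
  · intro hα
    refine ContMDiffAt.congr_of_eventuallyEq ((contMDiffAt_tangentMap
      (p := ⟨𝒟.u x, (h.fibreEquiv h𝒟 x (α x)).1⟩) (h.smooth_inverse x)).comp x hα)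
      (.of_forall fun y => ?_)
    exact totalSpace_mk_eq (h.inverse_u y).symm (h.mfderiv_inverse_mfderiv y (α y).1).symm

/-- Functoriality gives `φ ∘ L_g = L_{φ g} ∘ φ` on the fibre, so the extensions of `α` and of its
image are `φ`-related on all of `C`. -/
theorem mfderiv_leftExtension (h𝒞 : 𝒞.IsLieCategory F I) (h𝒟 : 𝒟.IsLieCategory F I)
    (hu : ∀ x, 𝒞.u x ∈ I.interior C) (α : ∀ x, 𝒞.leftFibre F I x) (g : C) :
    mfderiv I I φ g (𝒞.leftExtension F I α g) =
      𝒟.leftExtension F I (fun x => h.fibreEquiv h𝒟 x (α x)) (φ g) := by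
  have h1 := h𝒟.hasMFDerivWithinAt_m_left (φ g)
  rw [h.s_map] at h1
  have h2 := leftExtension_eq_of_s_eq (E := E) (I := I)
    (fun x => h.fibreEquiv h𝒟 x (α x)) (h.s_map g)
  refine Eq.trans ?_ h2.symm
  exact mfderiv_leftExtension_eq h𝒞 hu α g (f' := 𝒟.m (φ g) ∘ φ)
    (h.smooth.contMDiffAt.mdifferentiableAt (by simp))
    (fun k hk => h.m_map g k (Eq.symm hk))
    (h1.comp_of_eq' (h.smooth.contMDiffAt.mdifferentiableAt
      (by simp)).hasMFDerivAt.hasMFDerivWithinAt (h.u_map _) (fun k hk => (h.t_map k).trans hk))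

theorem fibreEquiv_bracket (h𝒞 : 𝒞.IsLieCategory F I) (h𝒟 : 𝒟.IsLieCategory F I)
    (hu : ∀ x, 𝒞.u x ∈ I.interior C) (hu' : ∀ x, 𝒟.u x ∈ I.interior D)
    {α β : ∀ x, 𝒞.leftFibre F I x}
    (hα : (𝒞.leftAlgebroid F I).IsSmooth α) (hβ : (𝒞.leftAlgebroid F I).IsSmooth β) (x : X) :
    h.fibreEquiv h𝒟 x ((𝒞.leftAlgebroid F I).bracket α β x) =
      (𝒟.leftAlgebroid F I).bracket (fun y => h.fibreEquiv h𝒟 y (α y))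
        (fun y => h.fibreEquiv h𝒟 y (β y)) x := by
  have : CompleteSpace E := FiniteDimensional.complete ℝ E
  have : IsManifold I 1 C := isManifold_one
  have : IsManifold I 1 D := isManifold_one
  have hα' : (𝒟.leftAlgebroid F I).IsSmooth (fun y => h.fibreEquiv h𝒟 y (α y)) :=
    fun x => (h.isSmoothAt_iff h𝒟 α x).1 (hα x)
  have hβ' : (𝒟.leftAlgebroid F I).IsSmooth (fun y => h.fibreEquiv h𝒟 y (β y)) :=
    fun x => (h.isSmoothAt_iff h𝒟 β x).1 (hβ x)
  have h1 := mfderiv_mlieBracket_of_related (h.smooth.contMDiffAt (x := 𝒞.u x))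
    (mdifferentiableAt_of_contMDiff_field (contMDiff_leftExtension h𝒞 hu hα) _)
    (mdifferentiableAt_of_contMDiff_field (contMDiff_leftExtension h𝒞 hu hβ) _)
    (mdifferentiableAt_of_contMDiff_field (contMDiff_leftExtension h𝒟 hu' hα') _)
    (mdifferentiableAt_of_contMDiff_field (contMDiff_leftExtension h𝒟 hu' hβ') _)
    (.of_forall (h.mfderiv_leftExtension h𝒞 h𝒟 hu α))
    (.of_forall (h.mfderiv_leftExtension h𝒞 h𝒟 hu β))
  have h2 := tangentField_congr (mlieBracket I
    (𝒟.leftExtension F I fun y => h.fibreEquiv h𝒟 y (α y))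
    (𝒟.leftExtension F I fun y => h.fibreEquiv h𝒟 y (β y))) (h.u_map x)
  refine (congrArg (h.fibreEquiv h𝒟 x) (bracket_apply h𝒞 hu hα hβ x)).trans
    (Eq.trans ?_ (bracket_apply h𝒟 hu' hα' hβ' x).symm)
  exact Subtype.ext (h1.trans h2)

/-- The isomorphism of left Lie algebroids that the differential induces. -/
def leftAlgebroidIso (h𝒞 : 𝒞.IsLieCategory F I) (h𝒟 : 𝒟.IsLieCategory F I)
    (hu : ∀ x, 𝒞.u x ∈ I.interior C) (hu' : ∀ x, 𝒟.u x ∈ I.interior D) :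
    (𝒞.leftAlgebroid F I).Iso (𝒟.leftAlgebroid F I) where
  toLinearEquiv := h.fibreEquiv h𝒟
  smooth := h.isSmoothAt_iff h𝒟
  anchor x v := h.mfderiv_s_mfderiv h𝒟 x (show 𝒞.leftFibre F I x from v).1
  bracket _ _ hα hβ := h.fibreEquiv_bracket h𝒞 h𝒟 hu hu' hα hβ

theorem leftVal_leftAlgebroidIso (h𝒞 : 𝒞.IsLieCategory F I) (h𝒟 : 𝒟.IsLieCategory F I)
    (hu : ∀ x, 𝒞.u x ∈ I.interior C) (hu' : ∀ x, 𝒟.u x ∈ I.interior D) (x : X)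
    (v : (𝒞.leftAlgebroid F I).fibre x) :
    @Eq E (𝒟.leftVal F I ((h.leftAlgebroidIso h𝒞 h𝒟 hu hu').toLinearEquiv x v))
      (mfderiv I I φ (𝒞.u x) (𝒞.leftVal F I v)) :=
  rfl

end IsLocalIso

end Functor

end ArrowCat

end

/-! ### Invertible arrows are interior points. -/

section

theorem exists_eq_of_injective_of_comp_eq_zero {E F : Type*} [NormedAddCommGroup E]
    [NormedSpace ℝ E] [NormedAddCommGroup F] [NormedSpace ℝ F] [FiniteDimensional ℝ E]
    {A : E →L[ℝ] F} (hA : Function.Surjective A)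
    {P : (Fin (Module.finrank ℝ E - Module.finrank ℝ F) → ℝ) →L[ℝ] E}
    (hP : Function.Injective P) (hAP : ∀ w, A (P w) = 0) {v : E} (hv : A v = 0) :
    ∃ w, P w = v := by
  have h1 : LinearMap.range P.toLinearMap ≤ LinearMap.ker A.toLinearMap := by
    rintro _ ⟨w, rfl⟩
    exact hAP w
  have h2 := Submodule.eq_of_le_of_finrank_eq h1 (by
    rw [finrank_ker_of_surjective hA, LinearMap.finrank_range_of_inj hP]; simp)
  have h3 : v ∈ LinearMap.range P.toLinearMap := by rw [h2]; exact hv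
  exact h3

section Boundary

variable {E H C : Type*} [NormedAddCommGroup E] [NormedSpace ℝ E] [TopologicalSpace H]
  {I : ModelWithCorners ℝ E H} [TopologicalSpace C] [ChartedSpace H C]

/-- A point with `ℓ > 0` has an open neighbourhood inside the range of the model. -/
theorem apply_extChartAt_eq_zero_of_isBoundaryPoint {ℓ : E →L[ℝ] ℝ} (hℓ : range I = {x | 0 ≤ ℓ x})
    {g : C} (hg : I.IsBoundaryPoint g) : ℓ (extChartAt I g g) = 0 := by
  have h1 : extChartAt I g g ∈ range I := mem_range_self _
  rw [hℓ] at h1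
  refine le_antisymm (not_lt.1 fun h2 => ?_) h1
  refine hg.2 (mem_interior.2 ⟨{x | 0 < ℓ x}, ?_, isOpen_lt continuous_const ℓ.continuous, h2⟩)
  rw [hℓ]
  exact fun x hx => le_of_lt (show 0 < ℓ x from hx)

/-- A map from a vector space that meets the boundary is tangent to it. -/
theorem apply_mfderiv_eq_zero_of_isBoundaryPoint {ℓ : E →L[ℝ] ℝ} (hℓ : range I = {x | 0 ≤ ℓ x})
    {K : Type*} [NormedAddCommGroup K] [NormedSpace ℝ K] {ρ : K → C} {w : K}
    (hρ : MDifferentiableAt 𝓘(ℝ, K) I ρ w) (hb : I.IsBoundaryPoint (ρ w)) (v : K) :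
    ℓ (mfderiv 𝓘(ℝ, K) I ρ w v : E) = 0 := by
  have h1 : HasFDerivAt (fun z => extChartAt I (ρ w) (ρ z))
      (mfderiv 𝓘(ℝ, K) I ρ w : K →L[ℝ] E) w := by
    have h2 := hρ.hasMFDerivAt.2
    exact hasFDerivWithinAt_univ.1 (by simpa using! h2)
  -- In the chart, `ℓ` is nonnegative on all of `range I` and vanishes at the boundary point, so it
  -- has a minimum there and its derivative vanishes.
  have h3 : IsLocalMin (fun z => ℓ (extChartAt I (ρ w) (ρ z))) w := by
    refine .of_forall fun z => ?_
    refine (apply_extChartAt_eq_zero_of_isBoundaryPoint hℓ hb).trans_le ?_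
    have h4 : extChartAt I (ρ w) (ρ z) ∈ range I := mem_range_self _
    rwa [hℓ] at h4
  exact DFunLike.congr_fun (h3.hasFDerivAt_eq_zero (ℓ.hasFDerivAt.comp w h1)) v

end Boundary

namespace ArrowCat

section Core

variable {E H C F X : Type*} [NormedAddCommGroup E] [NormedSpace ℝ E] [FiniteDimensional ℝ E]
  [TopologicalSpace H]
  {I : ModelWithCorners ℝ E H} [TopologicalSpace C] [ChartedSpace H C] [IsManifold I ∞ C]
  [NormedAddCommGroup F] [NormedSpace ℝ F] [FiniteDimensional ℝ F]
  [TopologicalSpace X] [ChartedSpace F X]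
  [IsManifold 𝓘(ℝ, F) ∞ X] {𝒞 : ArrowCat C X}

/-- Invertible arrows lie in the interior. -/
theorem isInteriorPoint_of_isInverse (hI : IsBoundaryModel I) (h𝒞 : 𝒞.IsLieCategory F I)
    (hu : ∀ x, 𝒞.u x ∈ I.interior C) {g g' : C} (hg : 𝒞.IsInverse g g') :
    I.IsInteriorPoint g := by
  obtain ⟨ℓ, hℓ⟩ := hI
  by_contra hni
  have hb : I.IsBoundaryPoint g := (I.isInteriorPoint_or_isBoundaryPoint g).resolve_left hni
  obtain ⟨hs', ht', hgg, -⟩ := hg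
  obtain ⟨c⟩ := exists_fibreChart h𝒞 hu (𝒞.s g)
  obtain ⟨h1, h2, h3⟩ := (c.eventually_slice h𝒞.smooth_t).self_of_nhds
  rw [𝒞.t_u, c.κ_self] at h1 h2 h3
  set K := Fin (Module.finrank ℝ E - Module.finrank ℝ F) → ℝ
  set ξ : K → C := fun w => c.σ (𝒞.s g, w)
  set ρ : K → C := fun w => 𝒞.m g (ξ w)
  have hρ0 : ρ 0 = g := by simp only [ρ, ξ, h1, 𝒞.m_u]
  have hρ : MDifferentiableAt 𝓘(ℝ, K) I ρ 0 :=
    (h𝒞.contMDiffAt_m contMDiffAt_const h3.self_of_nhds (by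
      filter_upwards [h2] with w hw using hw.symm)).mdifferentiableAt (by simp)
  have hξ : MDifferentiableAt 𝓘(ℝ, K) I ξ 0 := h3.self_of_nhds.mdifferentiableAt (by simp)
  -- Translation by `g'` takes `ρ` back to `ξ`, and `κ ∘ ξ` is the identity, so `dρ` has a left
  -- inverse.
  have hinj : Function.Injective (mfderiv 𝓘(ℝ, K) I ρ 0) := by
    have hL := ((h𝒞.contMDiffWithinAt_m_left hs').mdifferentiableWithinAt
      (by simp)).hasMFDerivWithinAt
    have h4 : ∀ᶠ w in 𝓝 (0 : K), 𝒞.t (ρ w) = 𝒞.s g' := by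
      filter_upwards [h2] with w hw
      rw [𝒞.t_m _ _ (Eq.symm hw), hs']
    have h5 := ((hL.comp_of_eq' (hρ.hasMFDerivAt.hasMFDerivWithinAt
      (s := {w | 𝒞.t (ρ w) = 𝒞.s g'})) hρ0 (fun w hw => hw)).hasMFDerivAt h4).mfderiv
    have h6 : 𝒞.m g' ∘ ρ =ᶠ[𝓝 0] ξ := by
      filter_upwards [h2] with w hw
      have hw' : 𝒞.t (ξ w) = 𝒞.s g := hw
      simp only [Function.comp_apply, ρ]
      rw [← 𝒞.assoc _ _ _ hs' hw'.symm, hgg, ← hw', 𝒞.u_m]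
    rw [h6.mfderiv_eq] at h5
    have h7 := mfderiv_comp_of_point_eq (c.smooth_κ.self_of_nhds.mdifferentiableAt (by simp)) hξ h1
    have h8 : (fun w => c.κ (ξ w)) =ᶠ[𝓝 0] id := by
      have h9 := c.κ_σ
      rw [𝒞.t_u] at h9
      exact ((Continuous.prodMk_right (𝒞.s g)).tendsto (0 : K)).eventually h9
    rw [h8.mfderiv_eq, mfderiv_id, h5] at h7
    intro v w hvw
    refine (DFunLike.congr_fun h7 v).trans (Eq.trans ?_ (DFunLike.congr_fun h7 w).symm)
    exact congrArg (fun z : E => (mfderiv I 𝓘(ℝ, K) c.κ (𝒞.u (𝒞.s g)) : E →L[ℝ] K)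
      ((mfderivWithin I I (𝒞.m g') (𝒞.tFibre (𝒞.s g')) g : E →L[ℝ] E) z)) hvw
  have htρ : ∀ w : K, @Eq F (mfderiv I 𝓘(ℝ, F) 𝒞.t g (mfderiv 𝓘(ℝ, K) I ρ 0 w)) 0 := by
    intro w
    have h4 := mfderiv_comp_of_point_eq (h𝒞.smooth_t.contMDiffAt.mdifferentiableAt (by simp)) hρ hρ0
    have h5 : (fun w => 𝒞.t (ρ w)) =ᶠ[𝓝 0] fun _ => 𝒞.t g := by
      filter_upwards [h2] with w hw using 𝒞.t_m _ _ (Eq.symm hw)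
    rw [h5.mfderiv_eq, mfderiv_const] at h4
    exact (DFunLike.congr_fun h4 w).symm
  -- By dimension, the range of `dρ` is all of `ker dt`; and `ρ` meets the boundary at `0`, so `ℓ`
  -- vanishes on this range.
  have hker : ∀ v : E, @Eq F (mfderiv I 𝓘(ℝ, F) 𝒞.t g v) 0 → ℓ v = 0 := by
    intro v hv
    obtain ⟨w, rfl⟩ := exists_eq_of_injective_of_comp_eq_zero (E := E) (F := F)
      (A := mfderiv I 𝓘(ℝ, F) 𝒞.t g) (P := mfderiv 𝓘(ℝ, K) I ρ 0) (h𝒞.submersion_t g) hinj htρ hv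
    exact apply_mfderiv_eq_zero_of_isBoundaryPoint hℓ hρ (by rwa [hρ0]) w
  -- Some `v'` tangent to the boundary has the same image as `v` under `dt`. Then `ℓ v' = 0`, while
  -- `v - v'` lies in `ker dt`, where `ℓ` vanishes too.
  have hzero : ∀ v : E, ℓ v = 0 := by
    intro v
    obtain ⟨v', ⟨γ, hγ, -, hγ0, hv'⟩, hvv⟩ :=
      h𝒞.boundary_submersion_t g hb (mfderiv I 𝓘(ℝ, F) 𝒞.t g v)
    have h4 : ℓ v' = 0 := by
      have := apply_mfderiv_eq_zero_of_isBoundaryPoint hℓ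
        (hγ.contMDiffAt.mdifferentiableAt (by simp)) (by rwa [hγ0]) (1 : ℝ)
      exact (congrArg ℓ hv').symm.trans this
    have h5 : ℓ (v - (show E from v')) = 0 := hker _ ((map_sub (mfderiv I 𝓘(ℝ, F) 𝒞.t g) v v').trans
      (sub_eq_zero.2 hvv.symm))
    rw [map_sub, h4, sub_zero] at h5
    exact h5
  refine hni ?_
  -- With `ℓ = 0` the model is the whole space and there is no boundary at all.
  have h6 : range I = univ := by rw [hℓ]; exact eq_univ_of_forall fun v => (hzero v).ge
  unfold ModelWithCorners.IsInteriorPoint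
  rw [h6, interior_univ]
  exact mem_univ _

end Core

end ArrowCat

end

/-! ### Smooth local inverses of invertible arrows. -/

section

section ImplicitFunction

variable {E H C K : Type*} [NormedAddCommGroup E] [NormedSpace ℝ E] [FiniteDimensional ℝ E]
  [TopologicalSpace H] {I : ModelWithCorners ℝ E H} [TopologicalSpace C] [ChartedSpace H C]
  [IsManifold I ∞ C] [NormedAddCommGroup K] [NormedSpace ℝ K] [FiniteDimensional ℝ K]

/-- The implicit function theorem for an equation `S (g, w) = k` in `w`. -/
theorem exists_implicit_function {S : C × K → K} {g : C} {w : K} (hg : I.IsInteriorPoint g)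
    (hS : ∀ᶠ z in 𝓝 (g, w), ContMDiffAt (I.prod 𝓘(ℝ, K)) 𝓘(ℝ, K) ∞ S z)
    (hd : Function.Injective (mfderiv 𝓘(ℝ, K) 𝓘(ℝ, K) (fun w => S (g, w)) w)) :
    ∃ r : C × K → K, r (g, S (g, w)) = w ∧ ∀ᶠ z in 𝓝 (g, S (g, w)),
      ContMDiffAt (I.prod 𝓘(ℝ, K)) 𝓘(ℝ, K) ∞ r z ∧ S (z.1, r z) = z.2 := by
  have : IsManifold I 1 C := isManifold_one
  have : CompleteSpace E := FiniteDimensional.complete ℝ E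
  have : CompleteSpace K := FiniteDimensional.complete ℝ K
  set φ := extChartAt I g
  have hφ : ∀ᶠ k in 𝓝 g, ContMDiffAt I 𝓘(ℝ, E) ∞ φ k := by
    filter_upwards [chart_source_mem_nhds H g] with k hk using contMDiffAt_extChartAt' hk
  have hφ' : ∀ᶠ z in 𝓝 (g, w), ContMDiffAt (I.prod 𝓘(ℝ, K)) 𝓘(ℝ, E) ∞ (fun z => φ z.1) z := by
    filter_upwards [(continuousAt_fst (p := (g, w))).eventually hφ] with z hz
    exact ContMDiffAt.comp z hz contMDiffAt_fst
  -- Keeping the first variable turns the equation into the inversion of `f`, whose derivative is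
  -- block triangular with an identity block; it is injective because the partial derivative in `w`
  -- is.
  set f : C × K → E × K := fun z => (φ z.1, S z) with hf
  have hfs : ∀ᶠ z in 𝓝 (g, w), ContMDiffAt (I.prod 𝓘(ℝ, K)) 𝓘(ℝ, E × K) ∞ f z := by
    filter_upwards [hφ', hS] with z h1 h2 using h1.prodMk_space h2
  have hint : (I.prod 𝓘(ℝ, K)).IsInteriorPoint (g, w) := by
    have : (g, w) ∈ (I.prod 𝓘(ℝ, K)).interior (C × K) := by
      rw [ModelWithCorners.interior_prod]
      exact ⟨hg, BoundarylessManifold.isInteriorPoint⟩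
    exact this
  have hSd := hS.self_of_nhds.mdifferentiableAt (by simp)
  have hφd : HasMFDerivAt I 𝓘(ℝ, E) φ g (ContinuousLinearMap.id ℝ E) := by
    have := (mdifferentiableAt_extChartAt (I := I) (ChartedSpace.mem_chart_source (H := H) g)).hasMFDerivAt
    rwa [mfderiv_extChartAt_self] at this
  have hfd : HasMFDerivAt (I.prod 𝓘(ℝ, K)) 𝓘(ℝ, E × K) f (g, w)
      (ContinuousLinearMap.prod (ContinuousLinearMap.fst ℝ E K)
        (mfderiv (I.prod 𝓘(ℝ, K)) 𝓘(ℝ, K) S (g, w) : E × K →L[ℝ] K)) := by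
    have h1 := HasMFDerivAt.comp (g, w) (f := Prod.fst) hφd
      (hasMFDerivAt_fst (I := I) (I' := 𝓘(ℝ, K)) (g, w))
    exact ⟨h1.1.prodMk hSd.hasMFDerivAt.1, h1.2.prodMk hSd.hasMFDerivAt.2⟩
  have hinj : Function.Injective (ContinuousLinearMap.prod (ContinuousLinearMap.fst ℝ E K)
      (mfderiv (I.prod 𝓘(ℝ, K)) 𝓘(ℝ, K) S (g, w) : E × K →L[ℝ] K)) := by
    refine (injective_iff_map_eq_zero _).2 ?_
    rintro ⟨v, k⟩ hvk
    obtain rfl : v = 0 := congrArg Prod.fst hvk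
    have h1 : (mfderiv (I.prod 𝓘(ℝ, K)) 𝓘(ℝ, K) S (g, w) : E × K →L[ℝ] K) (0, k) = 0 :=
      congrArg Prod.snd hvk
    have h2 := (mfderiv_snd_slice hSd k).trans h1
    have h3 : k = 0 := hd (h2.trans (map_zero _).symm)
    rw [h3]; rfl
  have hbij := And.intro hinj (LinearMap.surjective_of_injective
    (f := (ContinuousLinearMap.prod (ContinuousLinearMap.fst ℝ E K)
      (mfderiv (I.prod 𝓘(ℝ, K)) 𝓘(ℝ, K) S (g, w) : E × K →L[ℝ] K)).toLinearMap) hinj)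
  obtain ⟨r, hr0, hrs, hfr, -⟩ := exists_local_inverse hint hfs (by
    rw [hfd.mfderiv]
    exact hbij)
  have hj : ∀ᶠ z in 𝓝 (g, S (g, w)), ContMDiffAt (I.prod 𝓘(ℝ, K)) 𝓘(ℝ, E × K) ∞
      (fun z : C × K => (φ z.1, z.2)) z := by
    filter_upwards [(continuousAt_fst (p := (g, S (g, w)))).eventually hφ] with z hz
    exact ContMDiffAt.prodMk_space (ContMDiffAt.comp z hz contMDiffAt_fst) contMDiffAt_snd
  have hjt : Filter.Tendsto (fun z : C × K => (φ z.1, z.2)) (𝓝 (g, S (g, w))) (𝓝 (f (g, w))) :=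
    hj.self_of_nhds.continuousAt
  have hrt : Filter.Tendsto r (𝓝 (f (g, w))) (𝓝 (g, w)) := by
    have := hrs.self_of_nhds.continuousAt
    rwa [ContinuousAt, hr0] at this
  have hsrc := extChartAt_source_mem_nhds (I := I) g
  refine ⟨fun z => (r (φ z.1, z.2)).2, congrArg Prod.snd hr0, ?_⟩
  filter_upwards [hj, hjt.eventually hrs, hjt.eventually hfr,
    (hjt.eventually (hrt.eventually (continuousAt_fst.eventually hsrc))),
    (continuousAt_fst (p := (g, S (g, w)))).eventually hsrc] with z h1 h2 h3 h4 h5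
  refine ⟨contMDiffAt_snd.comp z (ContMDiffAt.comp z h2 h1), ?_⟩
  have h6 : (r (φ z.1, z.2)).1 = z.1 := φ.injOn h4 h5 (congrArg Prod.fst h3)
  have h7 : S (r (φ z.1, z.2)) = z.2 := congrArg Prod.snd h3
  exact (congrArg (fun x => S (x, (r (φ z.1, z.2)).2)) h6).symm.trans h7

end ImplicitFunction

theorem mfderiv_injective_of_leftInverse {E H M E' H' M' : Type*}
    [NormedAddCommGroup E] [NormedSpace ℝ E] [TopologicalSpace H] {I : ModelWithCorners ℝ E H}
    [TopologicalSpace M] [ChartedSpace H M]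
    [NormedAddCommGroup E'] [NormedSpace ℝ E'] [TopologicalSpace H'] {I' : ModelWithCorners ℝ E' H'}
    [TopologicalSpace M'] [ChartedSpace H' M'] {f : M → M'} {g : M' → M} {x : M} {y : M'}
    (hg : MDifferentiableAt I' I g y) (hf : MDifferentiableAt I I' f x) (hy : f x = y)
    (h : ∀ᶠ z in 𝓝 x, g (f z) = z) : Function.Injective (mfderiv I I' f x) := by
  have h1 := mfderiv_comp_of_point_eq hg hf hy
  have h2 : (fun z => g (f z)) =ᶠ[𝓝 x] id := h
  rw [h2.mfderiv_eq, mfderiv_id] at h1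
  intro v w hvw
  refine (DFunLike.congr_fun h1 v).trans (Eq.trans ?_ (DFunLike.congr_fun h1 w).symm)
  exact congrArg (mfderiv I' I g y) hvw

namespace ArrowCat

section Algebra

variable {C X : Type*} {𝒞 : ArrowCat C X}

theorem u_m_of_eq (𝒞 : ArrowCat C X) {g : C} {x : X} (h : 𝒞.t g = x) : 𝒞.m (𝒞.u x) g = g := by
  rw [← h, 𝒞.u_m]

theorem IsInverse.symm {g g' : C} (h : 𝒞.IsInverse g g') : 𝒞.IsInverse g' g :=
  ⟨h.2.1.symm, h.1.symm, by rw [h.2.2.2, h.1], by rw [h.2.2.1, h.2.1]⟩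

theorem IsInverse.op {g g' : C} (h : 𝒞.IsInverse g g') : 𝒞.op.IsInverse g g' :=
  ⟨h.2.1, h.1, h.2.2.2, h.2.2.1⟩

theorem eq_of_left_right_inverse {g l r : C} (hl : 𝒞.s l = 𝒞.t g) (hlg : 𝒞.m l g = 𝒞.u (𝒞.s g))
    (hr : 𝒞.t r = 𝒞.s g) (hgr : 𝒞.m g r = 𝒞.u (𝒞.t g)) : l = r := by
  have h1 := 𝒞.assoc l g r hl hr.symm
  rw [hlg, hgr, ← hr, 𝒞.u_m, ← hl, 𝒞.m_u] at h1
  exact h1.symm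

theorem isInverse_of_left_right_inverse {g l r : C} (hl : 𝒞.s l = 𝒞.t g)
    (hlg : 𝒞.m l g = 𝒞.u (𝒞.s g)) (hr : 𝒞.t r = 𝒞.s g) (hgr : 𝒞.m g r = 𝒞.u (𝒞.t g)) :
    𝒞.IsInverse g r := by
  obtain rfl := eq_of_left_right_inverse hl hlg hr hgr
  exact ⟨hl, hr, hlg, hgr⟩

theorem IsInverse.unique {g g' g'' : C} (h : 𝒞.IsInverse g g') (h' : 𝒞.IsInverse g g'') :
    g' = g'' :=
  eq_of_left_right_inverse h.1 h.2.2.1 h'.2.1 h'.2.2.2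

theorem isInverse_inv {g : C} (hg : ∃ g', 𝒞.IsInverse g g') : 𝒞.IsInverse g (𝒞.inv g) := by
  rw [inv, dif_pos hg]
  exact hg.choose_spec

theorem IsInverse.inv_eq {g g' : C} (h : 𝒞.IsInverse g g') : 𝒞.inv g = g' :=
  (isInverse_inv ⟨g', h⟩).unique h

end Algebra

section Core

variable {E H C F X : Type*} [NormedAddCommGroup E] [NormedSpace ℝ E] [FiniteDimensional ℝ E]
  [TopologicalSpace H]
  {I : ModelWithCorners ℝ E H} [TopologicalSpace C] [ChartedSpace H C] [IsManifold I ∞ C]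
  [NormedAddCommGroup F] [NormedSpace ℝ F] [FiniteDimensional ℝ F]
  [TopologicalSpace X] [ChartedSpace F X]
  [IsManifold 𝓘(ℝ, F) ∞ X] {𝒞 : ArrowCat C X}

/-- Smooth local right inverses near an invertible arrow. -/
theorem exists_smooth_right_inverse (hI : IsBoundaryModel I) (h𝒞 : 𝒞.IsLieCategory F I)
    (hu : ∀ x, 𝒞.u x ∈ I.interior C) {g g' : C} (hg : 𝒞.IsInverse g g') :
    ∃ R : C → C, ∀ᶠ k in 𝓝 g, ContMDiffAt I I ∞ R k ∧ 𝒞.t (R k) = 𝒞.s k ∧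
      𝒞.m k (R k) = 𝒞.u (𝒞.t k) := by
  obtain ⟨hs', ht', hgg, hgg'⟩ := id hg
  obtain ⟨r, ⟨c⟩, ⟨d⟩⟩ : ∃ r, Nonempty (FibreChart F I 𝒞.t g' r) ∧
      Nonempty (FibreChart F I 𝒞.t (𝒞.u (𝒞.t g)) r) :=
    ⟨_, nonempty_fibreChart h𝒞.smooth_t (isInteriorPoint_of_isInverse hI h𝒞 hu hg.symm)
      (h𝒞.submersion_t _) (finrank_eq_add_of_surjective (E := E) (F := F) (h𝒞.submersion_t g')),
      exists_fibreChart h𝒞 hu _⟩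
  set K := Fin r → ℝ
  have hσ := c.smooth_σ; have htσ := c.t_σ; have hσ0 := c.σ_self; have hκσ := c.κ_σ
  have hτ := d.smooth_σ; have htτ := d.t_σ; have hτ0 := d.σ_self
  rw [ht'] at hσ htσ hσ0 hκσ
  rw [𝒞.t_u] at hτ htτ hτ0
  -- the equation to be solved, and its inverse on the fibres through `g`
  set S : C × K → K := fun z => d.κ (𝒞.m z.1 (c.σ (𝒞.s z.1, z.2))) with hS
  set Q : C × K → C := fun z => 𝒞.m z.1 (c.σ (𝒞.s z.1, z.2)) with hQ
  have hproj : Filter.Tendsto (fun z : C × K => (𝒞.s z.1, z.2)) (𝓝 (g, 0)) (𝓝 (𝒞.s g, 0)) :=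
    ((h𝒞.smooth_s.continuous.comp continuous_fst).prodMk continuous_snd).continuousAt
  have hQ0 : Q (g, 0) = 𝒞.u (𝒞.t g) := by simp only [hQ, hσ0, hgg']
  have hQs : ∀ᶠ z in 𝓝 (g, (0 : K)), ContMDiffAt (I.prod 𝓘(ℝ, K)) I ∞ Q z := by
    filter_upwards [hproj.eventually hσ, (hproj.eventually htσ).eventually_nhds] with z h1 h2
    refine h𝒞.contMDiffAt_m contMDiffAt_fst (ContMDiffAt.comp z h1
      ((h𝒞.smooth_s.contMDiffAt.comp z contMDiffAt_fst).prodMk contMDiffAt_snd)) ?_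
    filter_upwards [h2] with y hy using hy.symm
  have hQt : Filter.Tendsto Q (𝓝 (g, 0)) (𝓝 (𝒞.u (𝒞.t g))) := by
    rw [← hQ0]; exact hQs.self_of_nhds.continuousAt
  have hSs : ∀ᶠ z in 𝓝 (g, (0 : K)), ContMDiffAt (I.prod 𝓘(ℝ, K)) 𝓘(ℝ, K) ∞ S z := by
    filter_upwards [hQs, hQt.eventually d.smooth_κ] with z h1 h2 using ContMDiffAt.comp z h2 h1
  have hS0 : S (g, 0) = 0 := (congrArg d.κ hQ0).trans d.κ_self
  have hslice : Filter.Tendsto (fun w : K => (g, w)) (𝓝 0) (𝓝 (g, 0)) :=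
    (Continuous.prodMk_right g).tendsto _
  -- Translation by `g'` in coordinates. Since `g' (g h) = h`, it undoes `S (g, ·)`, whose
  -- derivative is therefore injective, as the implicit function theorem requires.
  set Λ : K → K := fun w => c.κ (𝒞.m g' (d.σ (𝒞.t g, w))) with hΛ
  have hΛs : ContMDiffAt 𝓘(ℝ, K) 𝓘(ℝ, K) ∞ Λ 0 := by
    have h1 : ContMDiffAt 𝓘(ℝ, K) I ∞ (fun w => d.σ (𝒞.t g, w)) 0 :=
      ContMDiffAt.comp 0 hτ.self_of_nhds (contMDiffAt_const.prodMk contMDiffAt_id)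
    have h2 : ContMDiffAt 𝓘(ℝ, K) I ∞ (fun w => 𝒞.m g' (d.σ (𝒞.t g, w))) 0 :=
      h𝒞.contMDiffAt_m contMDiffAt_const h1 (by
        have := ((Continuous.prodMk_right (𝒞.t g)).tendsto (0 : K)).eventually htτ
        filter_upwards [this] with w hw using hs'.trans hw.symm)
    refine ContMDiffAt.comp 0 (g := c.κ) ?_ h2
    have h3 : 𝒞.m g' (d.σ (𝒞.t g, 0)) = g' := by rw [hτ0, ← hs', 𝒞.m_u]
    simp only [h3]
    exact c.smooth_κ.self_of_nhds
  have hΛS : ∀ᶠ w in 𝓝 (0 : K), Λ (S (g, w)) = w := by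
    filter_upwards [hslice.eventually (hQt.eventually d.σ_κ),
      hslice.eventually (hproj.eventually htσ), hslice.eventually (hproj.eventually hκσ)]
      with w h1 h2 h3
    have h2' : 𝒞.t (c.σ (𝒞.s g, w)) = 𝒞.s g := h2
    have h4 : 𝒞.t (Q (g, w)) = 𝒞.t g := 𝒞.t_m _ _ h2'.symm
    have h5 : d.σ (𝒞.t g, S (g, w)) = Q (g, w) :=
      (congrArg (fun x => d.σ (x, S (g, w))) h4).symm.trans h1
    simp only [hΛ, h5, hQ]
    rw [← 𝒞.assoc _ _ _ hs' h2'.symm, hgg, 𝒞.u_m_of_eq h2']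
    exact h3
  obtain ⟨η, hη0, hη⟩ := exists_implicit_function
    (isInteriorPoint_of_isInverse hI h𝒞 hu hg) hSs
    (mfderiv_injective_of_leftInverse (hΛs.mdifferentiableAt (by simp))
      ((hSs.self_of_nhds.comp 0 (contMDiffAt_const.prodMk contMDiffAt_id)).mdifferentiableAt
        (by simp)) hS0 hΛS)
  rw [hS0] at hη0 hη
  have hut : Filter.Tendsto (fun k => 𝒞.u (𝒞.t k)) (𝓝 g) (𝓝 (𝒞.u (𝒞.t g))) :=
    (h𝒞.smooth_u.comp h𝒞.smooth_t).continuous.continuousAt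
  have hj : ∀ᶠ k in 𝓝 g, ContMDiffAt I (I.prod 𝓘(ℝ, K)) ∞ (fun k => (k, d.κ (𝒞.u (𝒞.t k)))) k := by
    filter_upwards [hut.eventually d.smooth_κ] with k hk
    exact contMDiffAt_id.prodMk (ContMDiffAt.comp k hk (h𝒞.smooth_u.comp h𝒞.smooth_t).contMDiffAt)
  have hjt : Filter.Tendsto (fun k => (k, d.κ (𝒞.u (𝒞.t k)))) (𝓝 g) (𝓝 (g, 0)) := by
    have := hj.self_of_nhds.continuousAt
    rwa [ContinuousAt, d.κ_self] at this
  -- The solution makes `k · σ (s k, w k)` have the same fibre coordinate as the unit `u (t k)`.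
  set w : C → K := fun k => η (k, d.κ (𝒞.u (𝒞.t k))) with hw
  have hws : ∀ᶠ k in 𝓝 g, ContMDiffAt I 𝓘(ℝ, K) ∞ w k ∧ S (k, w k) = d.κ (𝒞.u (𝒞.t k)) := by
    filter_upwards [hj, hjt.eventually hη] with k h1 h2
    exact ⟨ContMDiffAt.comp k h2.1 h1, h2.2⟩
  have hw0 : w g = 0 := by simp only [hw, d.κ_self, hη0]
  have hwt : Filter.Tendsto (fun k => (k, w k)) (𝓝 g) (𝓝 (g, 0)) := by
    have := continuousAt_id.prodMk hws.self_of_nhds.1.continuousAt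
    rwa [ContinuousAt, hw0] at this
  refine ⟨fun k => c.σ (𝒞.s k, w k), ?_⟩
  filter_upwards [hws, hwt.eventually (hproj.eventually hσ), hwt.eventually (hproj.eventually htσ),
    hwt.eventually (hQt.eventually d.σ_κ), hut.eventually d.σ_κ] with k h1 h2 h3 h4 h5
  have h6 : 𝒞.t (c.σ (𝒞.s k, w k)) = 𝒞.s k := h3
  refine ⟨ContMDiffAt.comp k h2 (h𝒞.smooth_s.contMDiffAt.prodMk h1.1), h6, ?_⟩
  -- The product and the unit have the same target and the same fibre coordinate, so the chart
  -- identifies them.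
  have h7 : 𝒞.t (Q (k, w k)) = 𝒞.t k := 𝒞.t_m _ _ h6.symm
  rw [h7] at h4
  rw [𝒞.t_u, ← h1.2] at h5
  exact h4.symm.trans h5

/-- Near an invertible arrow, all arrows are invertible, and inversion is smooth. -/
theorem eventually_isInverse (hI : IsBoundaryModel I) (h𝒞 : 𝒞.IsLieCategory F I)
    (hu : ∀ x, 𝒞.u x ∈ I.interior C) {g g' : C} (hg : 𝒞.IsInverse g g') :
    (∀ᶠ k in 𝓝 g, k ∈ 𝒞.core) ∧ ContMDiffAt I I ∞ 𝒞.inv g := by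
  obtain ⟨R, hR⟩ := exists_smooth_right_inverse hI h𝒞 hu hg
  -- Right inverses in the opposite category are left inverses in the original one.
  obtain ⟨L, hL⟩ := exists_smooth_right_inverse (𝒞 := 𝒞.op) hI h𝒞.op hu hg.op
  have h1 : ∀ᶠ k in 𝓝 g, 𝒞.IsInverse k (R k) := by
    filter_upwards [hR, hL] with k ⟨_, h2, h3⟩ ⟨_, h4, h5⟩
    exact isInverse_of_left_right_inverse h4 h5 h2 h3
  refine ⟨h1.mono fun k hk => ⟨_, hk⟩, hR.self_of_nhds.1.congr_of_eventuallyEq ?_⟩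
  filter_upwards [h1] with k hk using hk.inv_eq

end Core

end ArrowCat

end

/-! ### The core as a Lie groupoid, and the functors used in the theorem. -/

section

namespace ArrowCat

section Algebra

variable {C X : Type*} {𝒞 : ArrowCat C X}

theorem isInverse_u (x : X) : 𝒞.IsInverse (𝒞.u x) (𝒞.u x) := by
  have h1 : 𝒞.m (𝒞.u x) (𝒞.u x) = 𝒞.u x := 𝒞.u_m_of_eq (𝒞.t_u x)
  exact ⟨by rw [𝒞.s_u, 𝒞.t_u], by rw [𝒞.s_u, 𝒞.t_u], by rw [𝒞.s_u, h1], by rw [𝒞.t_u, h1]⟩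

theorem IsInverse.comp {g g' h h' : C} (hg : 𝒞.IsInverse g g') (hh : 𝒞.IsInverse h h')
    (e : 𝒞.s g = 𝒞.t h) : 𝒞.IsInverse (𝒞.m g h) (𝒞.m h' g') := by
  obtain ⟨g1, g2, g3, g4⟩ := hg
  obtain ⟨h1, h2, h3, h4⟩ := hh
  have e' : 𝒞.s h' = 𝒞.t g' := by rw [h1, g2, e]
  refine ⟨?_, ?_, ?_, ?_⟩
  · rw [𝒞.s_m _ _ e', 𝒞.t_m _ _ e, g1]
  · rw [𝒞.t_m _ _ e', 𝒞.s_m _ _ e, h2]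
  · rw [𝒞.assoc _ _ _ e' (by rw [𝒞.t_m _ _ e, g1]), ← 𝒞.assoc g' g h g1 e, g3, e, 𝒞.u_m, h3,
      𝒞.s_m _ _ e]
  · rw [𝒞.assoc _ _ _ e (by rw [𝒞.t_m _ _ e', h2]), ← 𝒞.assoc h h' g' h2.symm e', h4, ← e, ← g2,
      𝒞.u_m, g4, 𝒞.t_m _ _ e]

variable [TopologicalSpace C] {hG : IsOpen 𝒞.core}

theorem coreCat_m_val {g h : 𝒞.coreOpens hG} (e : 𝒞.s g.1 = 𝒞.t h.1) :
    ((𝒞.coreCat hG).m g h).1 = 𝒞.m g.1 h.1 :=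
  congrArg Subtype.val (dif_pos e)

theorem coreCat_isInverse {g g' : 𝒞.coreOpens hG} (h : 𝒞.IsInverse g.1 g'.1) :
    (𝒞.coreCat hG).IsInverse g g' :=
  ⟨h.1, h.2.1, Subtype.ext ((coreCat_m_val h.1).trans h.2.2.1),
    Subtype.ext ((coreCat_m_val h.2.1.symm).trans h.2.2.2)⟩

theorem coreCat_isInverse_inv (g : 𝒞.coreOpens hG) :
    (𝒞.coreCat hG).IsInverse g ⟨𝒞.inv g.1, g.1, (isInverse_inv g.2).symm⟩ :=
  coreCat_isInverse (isInverse_inv g.2)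

open Classical in
/-- A retraction of all arrows to the invertible ones. -/
def coreRetraction (hG : IsOpen 𝒞.core) (g : C) : 𝒞.coreOpens hG :=
  if h : g ∈ 𝒞.core then ⟨g, h⟩ else ⟨𝒞.u (𝒞.s g), 𝒞.u_mem_core _⟩

theorem coreRetraction_val {g : C} (hg : g ∈ 𝒞.core) : (𝒞.coreRetraction hG g).1 = g :=
  congrArg Subtype.val (dif_pos hg)

end Algebra

section LocalIso

variable {E H C D F X : Type*} [NormedAddCommGroup E] [NormedSpace ℝ E]
  [TopologicalSpace H]
  {I : ModelWithCorners ℝ E H} [TopologicalSpace C] [ChartedSpace H C]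
  [TopologicalSpace D] [ChartedSpace H D]
  [NormedAddCommGroup F] [NormedSpace ℝ F]
  [TopologicalSpace X] [ChartedSpace F X] {𝒞 : ArrowCat C X} {𝒟 : ArrowCat D X}

theorem IsLocalIso.op {φ : C → D} {ψ : D → C} (h : IsLocalIso I 𝒞 𝒟 φ ψ) :
    IsLocalIso I 𝒞.op 𝒟.op φ ψ where
  smooth := h.smooth
  s_map := h.t_map
  t_map := h.s_map
  u_map := h.u_map
  m_map g k e := h.m_map k g e.symm
  smooth_inverse := h.smooth_inverse
  inverse_map := h.inverse_map
  map_inverse := h.map_inverse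

/-- Inversion in a Lie groupoid is an isomorphism to the opposite groupoid. -/
theorem IsLieGroupoid.isLocalIso_inv (h : 𝒞.IsLieGroupoid F I) :
    IsLocalIso I 𝒞 𝒞.op 𝒞.inv 𝒞.inv := by
  have hi : ∀ g, 𝒞.IsInverse g (𝒞.inv g) := fun g => isInverse_inv (h.invertible g)
  exact
    { smooth := h.smooth_inv
      s_map := fun g => (hi g).2.1
      t_map := fun g => (hi g).1
      u_map := fun x => (isInverse_u x).inv_eq
      m_map := fun g k e => ((hi g).comp (hi k) e).inv_eq
      smooth_inverse := fun x => .of_forall h.smooth_inv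
      inverse_map := fun x => .of_forall fun g => (hi g).symm.inv_eq
      map_inverse := fun x => .of_forall fun g => (hi g).symm.inv_eq }

theorem contMDiffAt_coreRetraction (hG : IsOpen 𝒞.core) {g : C} (hg : g ∈ 𝒞.core) :
    ContMDiffAt I I ∞ (𝒞.coreRetraction hG) g := by
  rw [← ContMDiffAt.subtypeVal_comp_iff]
  refine contMDiffAt_id.congr_of_eventuallyEq ?_
  filter_upwards [hG.mem_nhds hg] with k hk using coreRetraction_val hk

/-- The inclusion of the core. -/
theorem isLocalIso_val (hG : IsOpen 𝒞.core) :
    IsLocalIso I (𝒞.coreCat hG) 𝒞 Subtype.val (𝒞.coreRetraction hG) where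
  smooth := contMDiff_subtype_val
  s_map _ := rfl
  t_map _ := rfl
  u_map _ := rfl
  m_map _ _ e := coreCat_m_val e
  smooth_inverse x := by
    filter_upwards [hG.mem_nhds (𝒞.u_mem_core x)] with g hg using contMDiffAt_coreRetraction hG hg
  inverse_map x := .of_forall fun g => Subtype.ext (coreRetraction_val g.2)
  map_inverse x := by
    filter_upwards [hG.mem_nhds (𝒞.u_mem_core x)] with g hg using coreRetraction_val hg

theorem mfderiv_val_surjective (hG : IsOpen 𝒞.core) (g : 𝒞.coreOpens hG) :
    Function.Surjective (mfderiv I I (Subtype.val : 𝒞.coreOpens hG → C) g) := by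
  have h1 := mfderiv_comp_of_point_eq (I := I) (I' := I) (I'' := I)
    (contMDiff_subtype_val.contMDiffAt.mdifferentiableAt (n := ∞) (by simp))
    ((contMDiffAt_coreRetraction hG g.2).mdifferentiableAt (by simp))
    (Subtype.ext (coreRetraction_val g.2) : 𝒞.coreRetraction hG g.1 = g)
  have h2 : (fun k => (𝒞.coreRetraction hG k).1) =ᶠ[𝓝 g.1] id := by
    filter_upwards [hG.mem_nhds g.2] with k hk using coreRetraction_val hk
  rw [h2.mfderiv_eq, mfderiv_id] at h1
  exact fun v => ⟨_, (DFunLike.congr_fun h1 v).symm⟩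

/-- On an open subset all local conditions are inherited through the inclusion, and the conditions
along the boundary are vacuous. -/
theorem coreCat_isLieCategory (h𝒞 : 𝒞.IsLieCategory F I) (hG : IsOpen 𝒞.core)
    [BoundarylessManifold I (𝒞.coreOpens hG)] : (𝒞.coreCat hG).IsLieCategory F I where
  smooth_s := h𝒞.smooth_s.comp contMDiff_subtype_val
  smooth_t := h𝒞.smooth_t.comp contMDiff_subtype_val
  submersion_s g := by
    have h1 := mfderiv_comp_of_point_eq (h𝒞.smooth_s.contMDiffAt.mdifferentiableAt (by simp))
      (contMDiff_subtype_val.contMDiffAt.mdifferentiableAt (n := ∞) (by simp))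
      (rfl : (g : C) = g.1)
    intro w
    obtain ⟨v, hv⟩ := h𝒞.submersion_s g.1 w
    obtain ⟨v', rfl⟩ := mfderiv_val_surjective hG g v
    exact ⟨v', (DFunLike.congr_fun h1 v').trans hv⟩
  submersion_t g := by
    have h1 := mfderiv_comp_of_point_eq (h𝒞.smooth_t.contMDiffAt.mdifferentiableAt (by simp))
      (contMDiff_subtype_val.contMDiffAt.mdifferentiableAt (n := ∞) (by simp))
      (rfl : (g : C) = g.1)
    intro w
    obtain ⟨v, hv⟩ := h𝒞.submersion_t g.1 w
    obtain ⟨v', rfl⟩ := mfderiv_val_surjective hG g v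
    exact ⟨v', (DFunLike.congr_fun h1 v').trans hv⟩
  smooth_u := (ContMDiff.subtypeVal_comp_iff _ _).1 h𝒞.smooth_u
  smooth_m p hp := by
    rw [← ContMDiffWithinAt.subtypeVal_comp_iff]
    have h1 : ContMDiffWithinAt (I.prod I) I ∞
        (fun q : 𝒞.coreOpens hG × 𝒞.coreOpens hG => 𝒞.m q.1.1 q.2.1)
        (𝒞.coreCat hG).composable p :=
      (h𝒞.smooth_m (p.1.1, p.2.1) hp).comp p
        ((contMDiff_subtype_val.comp contMDiff_fst).prodMk
          (contMDiff_subtype_val.comp contMDiff_snd)).contMDiffAt.contMDiffWithinAt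
        (fun _ hq => hq)
    exact h1.congr (fun q hq => coreCat_m_val hq) (coreCat_m_val hp)
  boundary_submersion_s g hg := by
    rw [ModelWithCorners.Boundaryless.boundary_eq_empty] at hg
    exact hg.elim
  boundary_submersion_t g hg := by
    rw [ModelWithCorners.Boundaryless.boundary_eq_empty] at hg
    exact hg.elim

end LocalIso

section Core

variable {E H C F X : Type*} [NormedAddCommGroup E] [NormedSpace ℝ E] [FiniteDimensional ℝ E]
  [TopologicalSpace H]
  {I : ModelWithCorners ℝ E H} [TopologicalSpace C] [ChartedSpace H C] [IsManifold I ∞ C]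
  [NormedAddCommGroup F] [NormedSpace ℝ F] [FiniteDimensional ℝ F]
  [TopologicalSpace X] [ChartedSpace F X]
  [IsManifold 𝓘(ℝ, F) ∞ X] {𝒞 : ArrowCat C X}

theorem isOpen_core (hI : IsBoundaryModel I) (h𝒞 : 𝒞.IsLieCategory F I)
    (hu : ∀ x, 𝒞.u x ∈ I.interior C) : IsOpen 𝒞.core :=
  isOpen_iff_mem_nhds.2 fun _ ⟨_, hg⟩ => (eventually_isInverse hI h𝒞 hu hg).1

theorem boundarylessManifold_core (hI : IsBoundaryModel I) (h𝒞 : 𝒞.IsLieCategory F I)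
    (hu : ∀ x, 𝒞.u x ∈ I.interior C) (hG : IsOpen 𝒞.core) :
    BoundarylessManifold I (𝒞.coreOpens hG) :=
  ⟨fun g => ModelWithCorners.isInteriorPoint_iff_isInteriorPoint_val.2
    (isInteriorPoint_of_isInverse hI h𝒞 hu (isInverse_inv g.2))⟩

theorem coreCat_isLieGroupoid (hI : IsBoundaryModel I) (h𝒞 : 𝒞.IsLieCategory F I)
    (hu : ∀ x, 𝒞.u x ∈ I.interior C) (hG : IsOpen 𝒞.core) :
    (𝒞.coreCat hG).IsLieGroupoid F I where
  isLieCategory :=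
    have := boundarylessManifold_core hI h𝒞 hu hG
    coreCat_isLieCategory h𝒞 hG
  invertible g := ⟨_, coreCat_isInverse_inv g⟩
  smooth_inv := by
    rw [← ContMDiff.subtypeVal_comp_iff]
    have h1 : Subtype.val ∘ (𝒞.coreCat hG).inv = 𝒞.inv ∘ Subtype.val :=
      funext fun g => congrArg Subtype.val (coreCat_isInverse_inv g).inv_eq
    rw [h1]
    intro g
    exact (eventually_isInverse hI h𝒞 hu (isInverse_inv g.2)).2.comp g
      contMDiff_subtype_val.contMDiffAt

end Core

end ArrowCat

end

end

theorem mainTheorem6 {E H C F X : Type*}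
    [NormedAddCommGroup E] [NormedSpace ℝ E] [FiniteDimensional ℝ E]
    [TopologicalSpace H] (I : ModelWithCorners ℝ E H) (hI : IsBoundaryModel I)
    [TopologicalSpace C] [ChartedSpace H C] [IsManifold I ∞ C]
    [NormedAddCommGroup F] [NormedSpace ℝ F] [FiniteDimensional ℝ F]
    [TopologicalSpace X] [ChartedSpace F X] [IsManifold 𝓘(ℝ, F) ∞ X]
    (𝒞 : ArrowCat C X) (h𝒞 : 𝒞.IsLieCategory F I)
    (hu : ∀ x, 𝒞.u x ∈ I.interior C) :
    -- the core is open, and it is a Lie groupoid without boundary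
    ∃ hG : IsOpen 𝒞.core,
      BoundarylessManifold I (𝒞.coreOpens hG) ∧
      (𝒞.coreCat hG).IsLieGroupoid F I ∧
      -- all algebroids involved are Lie algebroids
      𝒞.HasLeftAlgebroid F I ∧ 𝒞.HasRightAlgebroid F I ∧
      (𝒞.coreCat hG).HasLeftAlgebroid F I ∧
      (𝒞.coreCat hG).HasRightAlgebroid F I ∧
      -- the inclusion induces an isomorphism from `A^L(G(C))` to `A^L(C)`
      (∃ Φ : ((𝒞.coreCat hG).leftAlgebroid F I).Iso (𝒞.leftAlgebroid F I),
        ∀ x v, 𝒞.leftVal F I (Φ.toLinearEquiv x v) =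
          mfderiv I I (Subtype.val : 𝒞.coreOpens hG → C) ((𝒞.coreCat hG).u x)
            ((𝒞.coreCat hG).leftVal F I v)) ∧
      -- inversion in `G(C)` induces an isomorphism from `A^L(G(C))` to `A^R(G(C))`
      (∃ Ψ : ((𝒞.coreCat hG).leftAlgebroid F I).Iso
          ((𝒞.coreCat hG).rightAlgebroid F I),
        ∀ x v, ((𝒞.coreCat hG).rightVal F I (Ψ.toLinearEquiv x v) : E) =
          mfderiv I I (𝒞.coreCat hG).inv ((𝒞.coreCat hG).u x) ((𝒞.coreCat hG).leftVal F I v)) ∧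
      -- the inclusion induces an isomorphism from `A^R(G(C))` to `A^R(C)`
      (∃ Φ : ((𝒞.coreCat hG).rightAlgebroid F I).Iso (𝒞.rightAlgebroid F I),
        ∀ x v, 𝒞.rightVal F I (Φ.toLinearEquiv x v) =
          mfderiv I I (Subtype.val : 𝒞.coreOpens hG → C) ((𝒞.coreCat hG).u x)
            ((𝒞.coreCat hG).rightVal F I v)) := by
  have hG := 𝒞.isOpen_core hI h𝒞 hu
  have hb := ArrowCat.boundarylessManifold_core hI h𝒞 hu hG
  have hgr := ArrowCat.coreCat_isLieGroupoid hI h𝒞 hu hG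
  have hG𝒞 := hgr.isLieCategory
  have huG : ∀ x, (𝒞.coreCat hG).u x ∈ I.interior (𝒞.coreOpens hG) :=
    fun x => BoundarylessManifold.isInteriorPoint
  have hι := ArrowCat.isLocalIso_val (I := I) hG
  -- Right algebroids are the left ones of opposite categories, so each right-hand claim is a
  -- left-hand one for `op`. Inversion ends in the opposite groupoid, whose left algebroid is the
  -- right algebroid of the core.
  refine ⟨hG, hb, hgr, ArrowCat.hasLeftAlgebroid h𝒞 hu, ArrowCat.hasLeftAlgebroid h𝒞.op hu,
    ArrowCat.hasLeftAlgebroid hG𝒞 huG, ArrowCat.hasLeftAlgebroid hG𝒞.op huG,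
    ⟨hι.leftAlgebroidIso hG𝒞 h𝒞 huG hu, hι.leftVal_leftAlgebroidIso hG𝒞 h𝒞 huG hu⟩,
    ⟨hgr.isLocalIso_inv.leftAlgebroidIso hG𝒞 hG𝒞.op huG huG,
      hgr.isLocalIso_inv.leftVal_leftAlgebroidIso hG𝒞 hG𝒞.op huG huG⟩,
    ⟨hι.op.leftAlgebroidIso hG𝒞.op h𝒞.op huG hu,
      hι.op.leftVal_leftAlgebroidIso hG𝒞.op h𝒞.op huG hu⟩⟩
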